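/- Let $t\in\mathbb{C}$ with $0<|t|<1$, let $\mathbb{S}^3\subset\mathbb{C}^2$ be the unit sphere with surface measure, and put $$\mathcal{L}=\bar z_1\frac{\partial}{\partial z_2}-\bar z_2\frac{\partial}{\partial z_1},\quad \bar{\mathcal{L}}=z_1\frac{\partial}{\partial \bar z_2}-z_2\frac{\partial}{\partial \bar z_1},\quad \mathcal{L}_t=\mathcal{L}+\bar t\,\bar{\mathcal{L}},\quad \bar{\mathcal{L}}_t=\bar{\mathcal{L}}+t\,\mathcal{L},\quad h=\frac{1+|t|^2}{(1-|t|^2)^2}.$$ Let $\square_b^t=-\mathcal{L}_t\,h\,\bar{\mathcal{L}}_t$ on $C^\infty(\mathbb{S}^3)$, and denote its closure in $L^2(\mathbb{S}^3)$ by the same symbol. For an unbounded operator the essential spectrum is the set of those points of the spectrum that are accumulation points of the spectrum or have an infinite dimensional eigenspace. Then: 1. $\square_b^t$ is self-adjoint in $L^2(\mathbb{S}^3)$. 2. $0$ is in the essential spectrum of $\square_b^t$; moreover $0$ is an accumulation point of the spectrum of $\square_b^t$. 3. Let $k\ge 1$, and let $f\neq 0$ be the restriction to $\mathbb{S}^3$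 of a harmonic polynomial that is homogeneous of degree $0$ in $z$ and of degree $2k-1$ in $\bar z$. Then $W=\operatorname{span}\{\bar{\mathcal{L}}f,\bar{\mathcal{L}}^3f,\dots,\bar{\mathcal{L}}^{2k-1}f\}$ consists of restrictions to $\mathbb{S}^3$ of homogeneous harmonic polynomials of degree $2k-1$, it is invariant under $\square_b^t$, and the smallest (real) eigenvalue $\lambda_{\min}$ of $\square_b^t$ on $W$ exists and satisfies $$0<\lambda_{\min}\le h\,(2k-1)\sqrt{k}\,|t|^{2k}.$$ 4. The Rossi sphere $(\mathbb{S}^3,\mathcal{L}_t)$ is not globally CR-embeddable: for no $N$ is there a smooth embedding $\mathbb{S}^3\to\mathbb{C}^N$ whose components are all annihilated by $\bar{\mathcal{L}}_t$. -/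

import Mathlib

open scoped Manifold ContDiff Topology ComplexConjugate
open MeasureTheory

noncomputable section

namespace Rossi

/-- The space `ℂ²` with its Hermitian norm. -/
abbrev C2 := EuclideanSpace ℂ (Fin 2)

instance finrankC2 : Fact (Module.finrank ℝ C2 = 3 + 1) := ⟨by
  rw [← Module.finrank_mul_finrank ℝ ℂ C2]; simp⟩

/-- The unit sphere `𝕊³ ⊂ ℂ²` (with Mathlib's smooth structure). -/
abbrev S3 := Metric.sphere (0 : C2) 1

/-- The surface area measure on `𝕊³`. -/
abbrev sigma : Measure S3 := Measure.toSphere (volume : Measure C2)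

/-- The Hilbert space `L²(𝕊³)`. -/
abbrev L2S3 := Lp ℂ 2 sigma

/-- The complex vector space `C^∞(𝕊³)` of smooth complex valued functions on the sphere. -/
def Smooth : Submodule ℂ (S3 → ℂ) where
  carrier := {f | ContMDiff (𝓡 3) 𝓘(ℝ, ℂ) ∞ f}
  add_mem' hf hg := ContMDiff.add hf hg
  zero_mem' := contMDiff_const
  smul_mem' c _ hf := by
    have h : ContMDiff 𝓘(ℝ, ℂ) 𝓘(ℝ, ℂ) ∞ (fun w : ℂ => c * w) :=
      (contDiff_const.mul contDiff_id).contMDiff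
    exact h.comp hf

/-- The extension of a function on `𝕊³` to `ℂ² \ {0}` that is constant on rays from the origin.
The complex vector fields below are tangent to the sphere, so that any other smooth extension
gives the same derivative on the sphere. -/
def ext (f : S3 → ℂ) (z : C2) : ℂ :=
  if h : z = 0 then 0 else f ⟨(‖z‖⁻¹ : ℝ) • z, by simp [norm_smul, h]⟩

/-- The Wirtinger derivative `∂F/∂z_j`. -/
def dz (j : Fin 2) (F : C2 → ℂ) (z : C2) : ℂ :=
  (1 / 2 : ℂ) * (fderiv ℝ F z (EuclideanSpace.single j 1)
    - Complex.I * fderiv ℝ F z (EuclideanSpace.single j Complex.I))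

/-- The Wirtinger derivative `∂F/∂z̄_j`. -/
def dzbar (j : Fin 2) (F : C2 → ℂ) (z : C2) : ℂ :=
  (1 / 2 : ℂ) * (fderiv ℝ F z (EuclideanSpace.single j 1)
    + Complex.I * fderiv ℝ F z (EuclideanSpace.single j Complex.I))

theorem ext_coe (f : S3 → ℂ) (z : S3) : ext f z = f z := by
  have hz : ‖(z : C2)‖ = 1 := by simp
  have h0 : (z : C2) ≠ 0 := by
    intro h
    simp [h] at hz
  simp only [ext, h0, dite_false]
  congr 1
  ext1
  simp [hz]

theorem ext_contDiffOn {f : S3 → ℂ} (hf : f ∈ Smooth) :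
    ContDiffOn ℝ ∞ (ext f) {0}ᶜ := by
  let U : TopologicalSpace.Opens C2 := ⟨{0}ᶜ, isOpen_compl_singleton⟩
  have hU : ∀ x : U, (x : C2) ≠ 0 := fun x => x.2
  have hc : ContMDiff 𝓘(ℝ, C2) 𝓘(ℝ, C2) ∞ (fun x : U => (‖(x : C2)‖⁻¹ : ℝ) • (x : C2)) := by
    intro x
    refine (contMDiffAt_subtype_iff (U := U)
      (f := fun y : C2 => (‖y‖⁻¹ : ℝ) • y) (x := x)).2 ?_
    refine ContDiffAt.contMDiffAt ?_
    exact ((contDiffAt_norm ℝ (hU x)).inv (norm_ne_zero_iff.2 (hU x))).smul contDiffAt_id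
  have hs := ContMDiff.codRestrict_sphere (n := 3) hc (fun x => by simp [norm_smul, hU x])
  have hcomp : ContMDiff 𝓘(ℝ, C2) 𝓘(ℝ, ℂ) ∞ (fun x : U => ext f x) := by
    refine (ContMDiff.comp (show ContMDiff (𝓡 3) 𝓘(ℝ, ℂ) ∞ f from hf) hs).congr ?_
    intro x
    simp only [ext, hU x, dite_false, Function.comp]
    rfl
  intro x hx
  refine ContDiffAt.contDiffWithinAt ?_
  exact ((contMDiffAt_subtype_iff (U := U) (x := ⟨x, hx⟩)).1 (hcomp ⟨x, hx⟩)).contDiffAt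

theorem ext_differentiableAt {f : S3 → ℂ} (hf : f ∈ Smooth) (z : S3) :
    DifferentiableAt ℝ (ext f) (z : C2) := by
  have h0 : (z : C2) ≠ 0 := by
    intro h
    have hz : ‖(z : C2)‖ = 1 := by simp
    simp [h] at hz
  exact ((ext_contDiffOn hf).contDiffAt (isOpen_compl_singleton.mem_nhds h0)).differentiableAt
    (by simp)

theorem restrict_smooth {F : C2 → ℂ} (hF : ContDiffOn ℝ ∞ F {0}ᶜ) :
    (fun z : S3 => F z) ∈ Smooth := by
  refine (hF.contMDiffOn).comp_contMDiff (contMDiff_coe_sphere (n := 3)) ?_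
  intro z h
  have hz : ‖(z : C2)‖ = 1 := by simp
  rw [Set.mem_singleton_iff.1 h] at hz
  simp at hz

theorem contDiffOn_fderiv_ext {f : S3 → ℂ} (hf : f ∈ Smooth) (v : C2) :
    ContDiffOn ℝ ∞ (fun z => fderiv ℝ (ext f) z v) {0}ᶜ :=
  ((ext_contDiffOn hf).fderiv_of_isOpen isOpen_compl_singleton (by simp)).clm_apply contDiffOn_const

theorem contDiff_coord (j : Fin 2) : ContDiff ℝ ∞ (fun z : C2 => z j) :=
  ((EuclideanSpace.proj (𝕜 := ℂ) j).restrictScalars ℝ).contDiff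

theorem contDiff_conj_coord (j : Fin 2) : ContDiff ℝ ∞ (fun z : C2 => conj (z j)) :=
  Complex.conjCLE.contDiff.comp (contDiff_coord j)

theorem contDiffOn_dz_ext {f : S3 → ℂ} (hf : f ∈ Smooth) (j : Fin 2) :
    ContDiffOn ℝ ∞ (dz j (ext f)) {0}ᶜ :=
  contDiffOn_const.mul ((contDiffOn_fderiv_ext hf _).sub
    (contDiffOn_const.mul (contDiffOn_fderiv_ext hf _)))

theorem contDiffOn_dzbar_ext {f : S3 → ℂ} (hf : f ∈ Smooth) (j : Fin 2) :
    ContDiffOn ℝ ∞ (dzbar j (ext f)) {0}ᶜ :=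
  contDiffOn_const.mul ((contDiffOn_fderiv_ext hf _).add
    (contDiffOn_const.mul (contDiffOn_fderiv_ext hf _)))

theorem fderiv_ext_add {f g : S3 → ℂ} (hf : f ∈ Smooth) (hg : g ∈ Smooth) (z : S3) :
    fderiv ℝ (ext (f + g)) (z : C2) = fderiv ℝ (ext f) z + fderiv ℝ (ext g) z := by
  rw [← fderiv_add (ext_differentiableAt hf z) (ext_differentiableAt hg z)]
  congr 1
  funext w
  by_cases h : w = 0 <;> simp [ext, h]

theorem fderiv_ext_smul (c : ℂ) {f : S3 → ℂ} (hf : f ∈ Smooth) (z : S3) :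
    fderiv ℝ (ext (c • f)) (z : C2) = c • fderiv ℝ (ext f) z := by
  rw [← fderiv_const_smul (ext_differentiableAt hf z) c]
  congr 1
  funext w
  by_cases h : w = 0 <;> simp [ext, h]

/-- The vector field `𝓛 = z̄₁ ∂/∂z₂ - z̄₂ ∂/∂z₁` acting on `C^∞(𝕊³)`
(`z₁`, `z₂` are the coordinates with index `0`, `1`). -/
def L : Module.End ℂ Smooth where
  toFun f := ⟨fun z => conj ((z : C2) 0) * dz 1 (ext f) z - conj ((z : C2) 1) * dz 0 (ext f) z,
    restrict_smooth (((contDiff_conj_coord 0).contDiffOn.mul (contDiffOn_dz_ext f.2 1)).sub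
      ((contDiff_conj_coord 1).contDiffOn.mul (contDiffOn_dz_ext f.2 0)))⟩
  map_add' f g := by
    ext z
    simp only [dz, Submodule.coe_add, fderiv_ext_add f.2 g.2, _root_.add_apply,
      Pi.add_apply]
    ring
  map_smul' c f := by
    ext z
    simp only [dz, Submodule.coe_smul, fderiv_ext_smul c f.2, _root_.smul_apply,
      Pi.smul_apply, smul_eq_mul, RingHom.id_apply]
    ring

/-- The conjugate vector field `𝓛̄ = z₁ ∂/∂z̄₂ - z₂ ∂/∂z̄₁` acting on `C^∞(𝕊³)`. -/
def Lbar : Module.End ℂ Smooth where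
  toFun f := ⟨fun z => (z : C2) 0 * dzbar 1 (ext f) z - (z : C2) 1 * dzbar 0 (ext f) z,
    restrict_smooth (((contDiff_coord 0).contDiffOn.mul (contDiffOn_dzbar_ext f.2 1)).sub
      ((contDiff_coord 1).contDiffOn.mul (contDiffOn_dzbar_ext f.2 0)))⟩
  map_add' f g := by
    ext z
    simp only [dzbar, Submodule.coe_add, fderiv_ext_add f.2 g.2, _root_.add_apply,
      Pi.add_apply]
    ring
  map_smul' c f := by
    ext z
    simp only [dzbar, Submodule.coe_smul, fderiv_ext_smul c f.2, _root_.smul_apply,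
      Pi.smul_apply, smul_eq_mul, RingHom.id_apply]
    ring

/-- The Rossi vector field `𝓛_t = 𝓛 + t̄ 𝓛̄`, which spans the CR structure of the Rossi sphere. -/
def Lt (t : ℂ) : Module.End ℂ Smooth := L + conj t • Lbar

/-- The conjugate Rossi vector field `𝓛̄_t = 𝓛̄ + t 𝓛`; its kernel consists of the smooth
CR functions. -/
def Ltbar (t : ℂ) : Module.End ℂ Smooth := Lbar + t • L

/-- The normalization constant `h = (1 + |t|²) / (1 - |t|²)²`. -/
def h (t : ℂ) : ℝ := (1 + ‖t‖ ^ 2) / (1 - ‖t‖ ^ 2) ^ 2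

/-- The Kohn Laplacian `□_b^t = -𝓛_t h 𝓛̄_t` on `C^∞(𝕊³)`. -/
def box (t : ℂ) : Module.End ℂ Smooth := -(Lt t * ((h t : ℂ) • Ltbar t))

/-- The inclusion of `C^∞(𝕊³)` into `L²(𝕊³)`. -/
def toL2 : Smooth →ₗ[ℂ] L2S3 :=
  (ContinuousMap.toLp 2 sigma ℂ).toLinearMap ∘ₗ
    { toFun := fun f => (⟨f.1, ContMDiff.continuous f.2⟩ : C(S3, ℂ))
      map_add' := fun _ _ => rfl
      map_smul' := fun _ _ => rfl }

theorem toL2_injective : Function.Injective toL2 := by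
  intro f g hfg
  have := ContinuousMap.toLp_injective sigma hfg
  exact Subtype.ext (congrArg (fun u : C(S3, ℂ) => (u : S3 → ℂ)) this)

/-- The Kohn Laplacian as an unbounded operator in `L²(𝕊³)` with domain `C^∞(𝕊³)`. -/
def boxSmooth (t : ℂ) : L2S3 →ₗ.[ℂ] L2S3 where
  domain := LinearMap.range toL2
  toFun := toL2 ∘ₗ box t ∘ₗ (LinearEquiv.ofInjective toL2 toL2_injective).symm.toLinearMap

/-- The Kohn Laplacian `□_b^t` as a closed unbounded operator in `L²(𝕊³)`: the closure of the
differential operator on smooth functions. -/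
def boxL2 (t : ℂ) : L2S3 →ₗ.[ℂ] L2S3 := (boxSmooth t).closure

section Spectrum

variable {H : Type*} [NormedAddCommGroup H] [InnerProductSpace ℂ H]

/-- `lam` is in the resolvent set of the unbounded operator `A`:
`A - lam` maps the domain of `A` bijectively to `H` with bounded inverse `R`. -/
def InResolventSet (A : H →ₗ.[ℂ] H) (lam : ℂ) : Prop :=
  ∃ R : H →L[ℂ] H,
    (∀ x : A.domain, R (A x - lam • (x : H)) = x) ∧
    (∀ y : H, ∃ x : A.domain, (x : H) = R y ∧ A x - lam • (x : H) = y)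

/-- The spectrum of an unbounded operator. -/
def spec (A : H →ₗ.[ℂ] H) : Set ℂ := {lam | ¬ InResolventSet A lam}

/-- The eigenspace `ker (A - lam)`. -/
def eigenspace (A : H →ₗ.[ℂ] H) (lam : ℂ) : Submodule ℂ A.domain :=
  LinearMap.ker (A.toFun - lam • A.domain.subtype)

/-- The essential spectrum (of a self-adjoint operator): the points of the spectrum that are not
isolated points of the spectrum with finite dimensional eigenspace. -/
def essSpec (A : H →ₗ.[ℂ] H) : Set ℂ :=
  {lam ∈ spec A | AccPt lam (Filter.principal (spec A)) ∨
    ¬ FiniteDimensional ℂ (eigenspace A lam)}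

end Spectrum

/-- Polynomials in `z₁, z₂, z̄₁, z̄₂`: `Sum.inl i` stands for `z_i` and `Sum.inr i` for `z̄_i`. -/
abbrev Poly := MvPolynomial (Fin 2 ⊕ Fin 2) ℂ

/-- The value of a polynomial in `z, z̄` at a point of `ℂ²`. -/
def Poly.value (P : Poly) (z : C2) : ℂ :=
  MvPolynomial.eval (Sum.elim (fun i => z i) (fun i => conj (z i))) P

/-- `Δ P = 4 ∑ ∂²P/∂z_i ∂z̄_i = 0`. -/
def Poly.IsHarmonic (P : Poly) : Prop :=
  4 * ∑ i : Fin 2, MvPolynomial.pderiv (Sum.inl i) (MvPolynomial.pderiv (Sum.inr i) P) = 0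

/-- `P` is homogeneous of bidegree `(p, q)`. -/
def Poly.IsBihomogeneous (P : Poly) (p q : ℕ) : Prop :=
  ∀ m ∈ P.support, m (Sum.inl 0) + m (Sum.inl 1) = p ∧ m (Sum.inr 0) + m (Sum.inr 1) = q

/-- `f ∈ 𝓗_m(𝕊³)`: a spherical harmonic of degree `m`. -/
def IsSphericalHarmonic (m : ℕ) (f : Smooth) : Prop :=
  ∃ P : Poly, P.IsHomogeneous m ∧ Poly.IsHarmonic P ∧ ∀ z : S3, f.1 z = Poly.value P z

/-- `f ∈ 𝓗_{p,q}(𝕊³)`: a spherical harmonic of bidegree `(p, q)`. -/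
def IsBisphericalHarmonic (p q : ℕ) (f : Smooth) : Prop :=
  ∃ P : Poly, Poly.IsBihomogeneous P p q ∧ Poly.IsHarmonic P ∧ ∀ z : S3, f.1 z = Poly.value P z

/-- `W = span {𝓛̄ f, 𝓛̄³ f, …, 𝓛̄^{2k-1} f}`. -/
def W (k : ℕ) (f : Smooth) : Submodule ℂ Smooth :=
  Submodule.span ℂ (Set.range fun j : Fin k => (Lbar ^ (2 * (j : ℕ) + 1)) f)

/-- A global CR embedding of the Rossi sphere `(𝕊³, 𝓛_t)` into `ℂ^N`: a smooth embedding whose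
components are CR functions. -/
def IsCREmbedding (t : ℂ) {N : ℕ} (g : Fin N → Smooth) : Prop :=
  Manifold.IsSmoothEmbedding (𝓡 3) 𝓘(ℝ, EuclideanSpace ℂ (Fin N)) ∞
    (fun z : S3 => (WithLp.toLp 2 fun j => (g j).1 z : EuclideanSpace ℂ (Fin N))) ∧
  ∀ j, Ltbar t (g j) = 0

end Rossi

end

/-! `L` and `Lbar` are combinations of derivatives along flows of isometries of the sphere, so
integration by parts gives `L* = -Lbar`, hence `Ltbar* = -Lt`, and the quadratic form of `box` is `h
‖Ltbar u‖²`. `box` maps polynomials in `z, z̄` of degree at most `n` to such polynomials. These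
finite dimensional spaces have dense union, so a symmetric operator preserving them has self-adjoint
closure (`LinearPMap.isSelfAdjoint_closure_of_invariant`).

The parity argument: with `a² = -t̄`, the linear forms `z̄₂ ± a z₁` and `z̄₁ ± a z₂` are
eigenvectors of the derivation `L_t` with eigenvalues `±a`, and they generate all polynomials. A
product of an odd number of them has as eigenvalue an odd multiple of `a`, which is nonzero, so a
function killed by `Ltbar` is orthogonal to it. Hence CR functions are even
(`antipode_eq_of_Ltbar_eq_zero`). They cannot separate antipodal points, which excludes embeddings;
and no nonzero odd function is CR, which makes the eigenvalues on `W` positive.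

The small eigenvalues: `L`, `Lbar` and their commutator span a copy of `sl₂`, and `f` generates a
string of mutually orthogonal vectors `Lbar^j f` with explicit norms. Among combinations of the odd
ones there is a `u` with coefficient 1 on the last vector such that `Ltbar u` is a multiple of `f`
of size `|t|^k` times a product of odd numbers (`exists_almost_CR`). Its Rayleigh quotient gives the
bound `h (2k-1) |t|^{2k}`, which is stronger than the one claimed and tends to 0, so 0 is an
accumulation point of positive eigenvalues. -/

noncomputable section

/-! ### Invariance of surface measure under linear isometries. -/

section SphereIsometry

variable {E : Type*} [NormedAddCommGroup E] [InnerProductSpace ℝ E]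

/-- The action of a linear isometry on the unit sphere. -/
def LinearIsometryEquiv.onSphere (U : E ≃ₗᵢ[ℝ] E) (z : Metric.sphere (0 : E) 1) :
    Metric.sphere (0 : E) 1 :=
  ⟨U z, by simp⟩

@[simp] theorem LinearIsometryEquiv.coe_onSphere (U : E ≃ₗᵢ[ℝ] E) (z : Metric.sphere (0 : E) 1) :
    (U.onSphere z : E) = U z := rfl

theorem LinearIsometryEquiv.continuous_onSphere (U : E ≃ₗᵢ[ℝ] E) : Continuous U.onSphere :=
  (U.continuous.comp continuous_subtype_val).subtype_mk _

/-- The surface measure of `s` is a multiple of the volume of the cone over `s`, and the cone over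
the preimage of `s` is the preimage of the cone. -/
theorem LinearIsometryEquiv.measurePreserving_onSphere [FiniteDimensional ℝ E] [MeasurableSpace E]
    [BorelSpace E] (U : E ≃ₗᵢ[ℝ] E) :
    MeasurePreserving U.onSphere (volume : Measure E).toSphere (volume : Measure E).toSphere := by
  refine ⟨U.continuous_onSphere.measurable, ?_⟩
  ext s hs
  have hs' : MeasurableSet (U.onSphere ⁻¹' s) := U.continuous_onSphere.measurable hs
  rw [Measure.map_apply U.continuous_onSphere.measurable hs, Measure.toSphere_apply' _ hs,
    Measure.toSphere_apply' _ hs']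
  congr 1
  conv_rhs => rw [← U.measurePreserving.measure_preimage_emb U.toHomeomorph.measurableEmbedding]
  congr 1
  ext x
  simp only [Set.mem_smul, Set.mem_image, Set.mem_preimage]
  constructor
  · rintro ⟨r, hr, _, ⟨y, hy, rfl⟩, h⟩
    exact ⟨r, hr, _, ⟨_, hy, rfl⟩, by simp [← h]⟩
  · rintro ⟨r, hr, _, ⟨y, hy, rfl⟩, h⟩
    refine ⟨r, hr, _, ⟨U.symm.onSphere y, ?_, rfl⟩, ?_⟩
    · convert hy
      ext1
      simp
    · apply U.injective
      simpa using h

end SphereIsometry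

namespace Rossi

/-! ### Flows tangent to the sphere, and integration by parts. -/

theorem C2_decomp (v : C2) :
    v = (v 0).re • EuclideanSpace.single 0 (1 : ℂ) + (v 0).im • EuclideanSpace.single 0 Complex.I
      + ((v 1).re • EuclideanSpace.single 1 (1 : ℂ)
        + (v 1).im • EuclideanSpace.single 1 Complex.I) := by
  ext j
  fin_cases j <;> simp [Complex.re_add_im]

theorem fderiv_eq_wirtinger (F : C2 → ℂ) (z v : C2) :
    fderiv ℝ F z v = v 0 * dz 0 F z + v 1 * dz 1 F z
      + conj (v 0) * dzbar 0 F z + conj (v 1) * dzbar 1 F z := by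
  conv_lhs => rw [C2_decomp v]
  simp only [map_add, map_smul, dz, dzbar, Complex.real_smul]
  have h0 : v 0 = (v 0).re + (v 0).im * Complex.I := (Complex.re_add_im _).symm
  have h1 : v 1 = (v 1).re + (v 1).im * Complex.I := (Complex.re_add_im _).symm
  have h0' : conj (v 0) = (v 0).re - (v 0).im * Complex.I := Complex.ext (by simp) (by simp)
  have h1' : conj (v 1) = (v 1).re - (v 1).im * Complex.I := Complex.ext (by simp) (by simp)
  rw [h0', h1']
  generalize (v 0).re = a0 at *
  generalize (v 0).im = b0 at *
  generalize (v 1).re = a1 at *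
  generalize (v 1).im = b1 at *
  rw [h0, h1]
  linear_combination ((b0 : ℂ) * fderiv ℝ F z (EuclideanSpace.single 0 Complex.I)
    + b1 * fderiv ℝ F z (EuclideanSpace.single 1 Complex.I)) * Complex.I_sq

/-- The real vector field `z ↦ c (-z̄₂, z̄₁)`, as a real linear map. -/
def quat (c : ℂ) : C2 →ₗ[ℝ] C2 where
  toFun z := !₂[-(c * conj (z 1)), c * conj (z 0)]
  map_add' x y := by
    ext j
    fin_cases j <;> simp <;> ring
  map_smul' r x := by
    ext j
    fin_cases j <;> simp <;> ring

@[simp] theorem quat_zero (c : ℂ) (z : C2) : quat c z 0 = -(c * conj (z 1)) := rfl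
@[simp] theorem quat_one (c : ℂ) (z : C2) : quat c z 1 = c * conj (z 0) := rfl

/-- Since `quat c` squares to `-1`, its exponential is `cos s + sin s • quat c`, the family
`rotLin`. -/
theorem quat_quat {c : ℂ} (hc : ‖c‖ = 1) (z : C2) : quat c (quat c z) = -z := by
  have : c * conj c = 1 := by rw [Complex.mul_conj']; simp [hc]
  ext j
  fin_cases j
  · simp only [Fin.zero_eta, quat_zero, quat_one, map_mul, Complex.conj_conj, PiLp.neg_apply]
    linear_combination -(z 0) * this
  · simp only [Fin.mk_one, quat_zero, quat_one, map_neg, map_mul, Complex.conj_conj,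
      PiLp.neg_apply]
    linear_combination -(z 1) * this

/-- The flow of `quat c`. -/
def rotLin (c : ℂ) (s : ℝ) : C2 →ₗ[ℝ] C2 := Real.cos s • LinearMap.id + Real.sin s • quat c

theorem norm_rotLin {c : ℂ} (hc : ‖c‖ = 1) (s : ℝ) (z : C2) : ‖rotLin c s z‖ = ‖z‖ := by
  have hcs := Real.cos_sq_add_sin_sq s
  have h : c.re ^ 2 + c.im ^ 2 = 1 := by
    have := Complex.sq_norm c
    rw [hc, Complex.normSq_apply] at this
    linarith
  rw [← sq_eq_sq₀ (norm_nonneg _) (norm_nonneg _), EuclideanSpace.norm_sq_eq,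
    EuclideanSpace.norm_sq_eq, Fin.sum_univ_two, Fin.sum_univ_two]
  simp only [Complex.sq_norm, Complex.normSq_apply]
  simp [rotLin, -Complex.ofReal_cos, -Complex.ofReal_sin]
  generalize Real.cos s = a at *
  generalize Real.sin s = b at *
  linear_combination ((z 0).re ^ 2 + (z 0).im ^ 2 + (z 1).re ^ 2 + (z 1).im ^ 2) *
    (hcs + b ^ 2 * h)

/-- The flow of `quat c` as a one-parameter family of isometries. -/
def rot {c : ℂ} (hc : ‖c‖ = 1) (s : ℝ) : C2 ≃ₗᵢ[ℝ] C2 :=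
  LinearIsometry.toLinearIsometryEquiv ⟨rotLin c s, norm_rotLin hc s⟩ rfl

theorem rot_apply {c : ℂ} (hc : ‖c‖ = 1) (s : ℝ) (z : C2) :
    rot hc s z = Real.cos s • z + Real.sin s • quat c z := rfl

theorem hasDerivAt_rot {c : ℂ} (hc : ‖c‖ = 1) (s : ℝ) (z : C2) :
    HasDerivAt (fun s => rot hc s z) (quat c (rot hc s z)) s := by
  simp only [rot_apply, map_add, map_smul, quat_quat hc]
  refine (((Real.hasDerivAt_cos s).smul_const z).add
    ((Real.hasDerivAt_sin s).smul_const (quat c z))).congr_deriv ?_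
  module

/-- The derivative along `quat c`, as a combination of `𝓛` and `𝓛̄`. -/
def X (c : ℂ) : Module.End ℂ Smooth := c • L + conj c • Lbar

theorem L_apply (f : Smooth) (z : S3) :
    (L f).1 z = conj ((z : C2) 0) * dz 1 (ext f.1) z - conj ((z : C2) 1) * dz 0 (ext f.1) z := rfl

theorem Lbar_apply (f : Smooth) (z : S3) :
    (Lbar f).1 z = (z : C2) 0 * dzbar 1 (ext f.1) z - (z : C2) 1 * dzbar 0 (ext f.1) z := rfl

theorem X_apply (c : ℂ) (f : Smooth) (z : S3) :
    (X c f).1 z = fderiv ℝ (ext f.1) z (quat c z) := by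
  have : (X c f).1 z = c * (L f).1 z + conj c * (Lbar f).1 z := rfl
  rw [this, fderiv_eq_wirtinger, L_apply, Lbar_apply]
  simp
  ring

theorem continuous_coe (f : Smooth) : Continuous f.1 := ContMDiff.continuous f.2

theorem hasDerivAt_comp_rot {c : ℂ} (hc : ‖c‖ = 1) (f : Smooth) (z : S3) (s : ℝ) :
    HasDerivAt (fun s => f.1 ((rot hc s).onSphere z)) ((X c f).1 ((rot hc s).onSphere z)) s := by
  have h := (ext_differentiableAt f.2 ((rot hc s).onSphere z)).hasFDerivAt.comp_hasDerivAt s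
    (hasDerivAt_rot hc s z)
  rw [X_apply]
  refine h.congr_of_eventuallyEq (Filter.Eventually.of_forall fun s => ?_)
  exact (ext_coe f.1 ((rot hc s).onSphere z)).symm

theorem integrable_of_continuous {f : S3 → ℂ} (hf : Continuous f) : Integrable f sigma :=
  hf.integrable_of_hasCompactSupport (HasCompactSupport.of_compactSpace f)

theorem inner_toL2 (f g : Smooth) :
    inner ℂ (toL2 f) (toL2 g) = ∫ z, g.1 z * conj (f.1 z) ∂sigma :=
  ContinuousMap.inner_toLp sigma _ _

/-- The integral of `g f̄` composed with the flow does not depend on time. Differentiating under the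
integral sign at time 0 gives the vanishing of the integral of `(X g) f̄ + g conj (X f)`. -/
theorem inner_X {c : ℂ} (hc : ‖c‖ = 1) (f g : Smooth) :
    inner ℂ (toL2 (X c f)) (toL2 g) = -inner ℂ (toL2 f) (toL2 (X c g)) := by
  set G : S3 → ℂ := fun z => g.1 z * conj (f.1 z)
  set G' : S3 → ℂ := fun z => (X c g).1 z * conj (f.1 z) + g.1 z * conj ((X c f).1 z)
  have c1 : Continuous fun z => (X c g).1 z * conj (f.1 z) :=
    (continuous_coe _).mul (Complex.continuous_conj.comp (continuous_coe _))
  have c2 : Continuous fun z => g.1 z * conj ((X c f).1 z) :=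
    (continuous_coe _).mul (Complex.continuous_conj.comp (continuous_coe _))
  have hGc : Continuous G := (continuous_coe _).mul (Complex.continuous_conj.comp (continuous_coe _))
  have hGc' : Continuous G' := c1.add c2
  obtain ⟨B, hB⟩ := isCompact_univ.exists_bound_of_continuousOn hGc'.continuousOn
  have key := (hasDerivAt_integral_of_dominated_loc_of_deriv_le (μ := sigma) (x₀ := (0 : ℝ))
    (s := Set.univ) (F := fun s z => G ((rot hc s).onSphere z))
    (F' := fun s z => G' ((rot hc s).onSphere z)) (bound := fun _ => B) Filter.univ_mem
    (Filter.Eventually.of_forall fun s =>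
      (hGc.comp (rot hc s).continuous_onSphere).aestronglyMeasurable)
    (integrable_of_continuous (hGc.comp (rot hc 0).continuous_onSphere))
    (hGc'.comp (rot hc 0).continuous_onSphere).aestronglyMeasurable
    (Filter.Eventually.of_forall fun z s _ => hB _ trivial) (integrable_const B)
    (Filter.Eventually.of_forall fun z s _ =>
      (hasDerivAt_comp_rot hc g z s).mul (hasDerivAt_comp_rot hc f z s).star)).2
  have hconst : ∀ (H : S3 → ℂ), Continuous H → ∀ s : ℝ,
      ∫ z, H ((rot hc s).onSphere z) ∂sigma = ∫ z, H z ∂sigma := fun H hH s => by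
    have := (rot hc s).measurePreserving_onSphere
    conv_rhs => rw [sigma, ← this.map_eq]
    exact (integral_map this.measurable.aemeasurable hH.aestronglyMeasurable).symm
  simp only [hconst G hGc, hconst G' hGc'] at key
  have h0 := key.unique (hasDerivAt_const (0 : ℝ) (∫ z, G z ∂sigma))
  rw [integral_add (integrable_of_continuous c1) (integrable_of_continuous c2)] at h0
  rw [inner_toL2, inner_toL2, eq_neg_iff_add_eq_zero, ← h0, add_comm]

/-- The real fields for `c = 1` and `c = i` determine `L`, because `2 L = X 1 - i X i`. -/
theorem inner_L (f g : Smooth) :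
    inner ℂ (toL2 (L f)) (toL2 g) = -inner ℂ (toL2 f) (toL2 (Lbar g)) := by
  have h1 := inner_X (c := 1) (by simp) f g
  have h2 := inner_X (c := Complex.I) (by simp) f g
  simp only [X, LinearMap.add_apply, LinearMap.smul_apply, map_add, map_smul, inner_add_left,
    inner_add_right, inner_smul_left, inner_smul_right, Complex.conj_I, map_one, map_neg] at h1 h2
  have h3 := Complex.I_mul_I
  linear_combination (1 / 2 : ℂ) * h1 + (Complex.I / 2) * h2 +
    (1 / 2 : ℂ) * (inner ℂ (toL2 (L f)) (toL2 g) - inner ℂ (toL2 (Lbar f)) (toL2 g)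
    - inner ℂ (toL2 f) (toL2 (L g)) + inner ℂ (toL2 f) (toL2 (Lbar g))) * h3

theorem inner_Lbar (f g : Smooth) :
    inner ℂ (toL2 (Lbar f)) (toL2 g) = -inner ℂ (toL2 f) (toL2 (L g)) := by
  rw [← inner_conj_symm, ← inner_conj_symm (toL2 f), inner_L g f]
  simp

theorem inner_Ltbar (t : ℂ) (f g : Smooth) :
    inner ℂ (toL2 (Ltbar t f)) (toL2 g) = -inner ℂ (toL2 f) (toL2 (Lt t g)) := by
  simp only [Ltbar, Lt, LinearMap.add_apply, LinearMap.smul_apply, map_add, map_smul,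
    inner_add_left, inner_add_right, inner_smul_left, inner_smul_right, inner_L, inner_Lbar]
  ring

theorem box_apply (t : ℂ) (f : Smooth) : box t f = -((h t : ℂ) • Lt t (Ltbar t f)) := by
  simp only [box, LinearMap.neg_apply, Module.End.mul_apply, LinearMap.smul_apply, map_smul]

theorem inner_box_right (t : ℂ) (f g : Smooth) :
    inner ℂ (toL2 f) (toL2 (box t g)) =
      (h t : ℂ) * inner ℂ (toL2 (Ltbar t f)) (toL2 (Ltbar t g)) := by
  rw [box_apply, map_neg, map_smul, inner_neg_right, inner_smul_right, inner_Ltbar]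
  ring

theorem inner_box_left (t : ℂ) (f g : Smooth) :
    inner ℂ (toL2 (box t f)) (toL2 g) = inner ℂ (toL2 f) (toL2 (box t g)) := by
  rw [← inner_conj_symm, inner_box_right, inner_box_right, map_mul, inner_conj_symm,
    Complex.conj_ofReal]

/-! ### Polynomials in `z, z̄`: differentiation and density. -/

namespace Poly

@[simp] theorem value_C (a : ℂ) (z : C2) : value (MvPolynomial.C a) z = a := by simp [value]
@[simp] theorem value_zero (z : C2) : value 0 z = 0 := by simp [value]
@[simp] theorem value_add (P Q : Poly) (z : C2) : value (P + Q) z = value P z + value Q z := by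
  simp [value]
@[simp] theorem value_mul (P Q : Poly) (z : C2) : value (P * Q) z = value P z * value Q z := by
  simp [value]
@[simp] theorem value_smul (c : ℂ) (P : Poly) (z : C2) : value (c • P) z = c * value P z := by
  simp [value]
@[simp] theorem value_X_inl (i : Fin 2) (z : C2) :
    value (MvPolynomial.X (Sum.inl i)) z = z i := by simp [value]
@[simp] theorem value_X_inr (i : Fin 2) (z : C2) :
    value (MvPolynomial.X (Sum.inr i)) z = conj (z i) := by simp [value]

theorem contDiff_value (P : Poly) : ContDiff ℝ ∞ (value P) := by
  induction P using MvPolynomial.induction_on with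
  | C a => exact (funext (value_C a) : value _ = _) ▸ contDiff_const
  | add p q hp hq => exact (funext (value_add p q) : value _ = _) ▸ hp.add hq
  | mul_X p n hp =>
    rcases n with i | i
    · rw [show value (p * .X (Sum.inl i)) = fun z => value p z * z i from
        funext fun z => by simp]
      exact hp.mul (contDiff_coord i)
    · rw [show value (p * .X (Sum.inr i)) = fun z => value p z * conj (z i) from
        funext fun z => by simp]
      exact hp.mul (contDiff_conj_coord i)

theorem hasFDerivAt_value (P : Poly) (z : C2) :
    ∃ A : C2 →L[ℝ] ℂ, HasFDerivAt (value P) A z ∧ ∀ v : C2, A v =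
      ∑ i, (v i * value (MvPolynomial.pderiv (Sum.inl i) P) z
        + conj (v i) * value (MvPolynomial.pderiv (Sum.inr i) P) z) := by
  induction P using MvPolynomial.induction_on with
  | C a =>
    refine ⟨0, ?_, by simp⟩
    exact (hasFDerivAt_const a z).congr_of_eventuallyEq (Filter.Eventually.of_forall (value_C a))
  | add p q hp hq =>
    obtain ⟨A, hA, hA'⟩ := hp
    obtain ⟨B, hB, hB'⟩ := hq
    refine ⟨A + B, (hA.add hB).congr_of_eventuallyEq (Filter.Eventually.of_forall
      (value_add p q)), fun v => ?_⟩
    simp only [add_apply, hA', hB', value_add, map_add, ← Finset.sum_add_distrib]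
    exact Finset.sum_congr rfl fun i _ => by ring
  | mul_X p n hp =>
    obtain ⟨A, hA, hA'⟩ := hp
    rcases n with i | i
    · have hp : HasFDerivAt (fun z : C2 => z i)
          ((EuclideanSpace.proj (𝕜 := ℂ) i).restrictScalars ℝ : C2 →L[ℝ] ℂ) z :=
        ((EuclideanSpace.proj (𝕜 := ℂ) i).restrictScalars ℝ : C2 →L[ℝ] ℂ).hasFDerivAt
      refine ⟨_, (hA.mul hp).congr_of_eventuallyEq (Filter.Eventually.of_forall fun w => by simp),
        fun v => ?_⟩
      fin_cases i <;> simp [hA', Pi.single_apply] <;> ring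
    · have hp : HasFDerivAt (fun z : C2 => conj (z i))
          (Complex.conjCLE.toContinuousLinearMap.comp
            ((EuclideanSpace.proj (𝕜 := ℂ) i).restrictScalars ℝ) : C2 →L[ℝ] ℂ) z :=
        (Complex.conjCLE.toContinuousLinearMap.comp
          ((EuclideanSpace.proj (𝕜 := ℂ) i).restrictScalars ℝ) : C2 →L[ℝ] ℂ).hasFDerivAt
      refine ⟨_, (hA.mul hp).congr_of_eventuallyEq (Filter.Eventually.of_forall fun w => by simp),
        fun v => ?_⟩
      fin_cases i <;> simp [hA', Pi.single_apply] <;> ring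

end Poly

/-- The restriction of a polynomial in `z, z̄` to the sphere. -/
def res : Poly →ₗ[ℂ] Smooth where
  toFun P := ⟨fun z => Poly.value P z, restrict_smooth P.contDiff_value.contDiffOn⟩
  map_add' P Q := by ext z; simp
  map_smul' c P := by ext z; simp

theorem res_apply (P : Poly) (z : S3) : (res P).1 z = Poly.value P z := rfl

/-- The derivation `𝓛` on polynomials. -/
def Lpoly : Derivation ℂ Poly Poly :=
  (MvPolynomial.X (Sum.inr 0) : Poly) • MvPolynomial.pderiv (Sum.inl 1)
    - (MvPolynomial.X (Sum.inr 1) : Poly) • MvPolynomial.pderiv (Sum.inl 0)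

/-- The derivation `𝓛̄` on polynomials. -/
def Lbarpoly : Derivation ℂ Poly Poly :=
  (MvPolynomial.X (Sum.inl 0) : Poly) • MvPolynomial.pderiv (Sum.inr 1)
    - (MvPolynomial.X (Sum.inl 1) : Poly) • MvPolynomial.pderiv (Sum.inr 0)

theorem Lpoly_apply (P : Poly) : Lpoly P =
    MvPolynomial.X (Sum.inr 0) * MvPolynomial.pderiv (Sum.inl 1) P
      - MvPolynomial.X (Sum.inr 1) * MvPolynomial.pderiv (Sum.inl 0) P := rfl

theorem Lbarpoly_apply (P : Poly) : Lbarpoly P =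
    MvPolynomial.X (Sum.inl 0) * MvPolynomial.pderiv (Sum.inr 1) P
      - MvPolynomial.X (Sum.inl 1) * MvPolynomial.pderiv (Sum.inr 0) P := rfl

/-- The radially constant extension `ext` and the polynomial differ off the sphere, but the flow
stays on the sphere. Both sides are the time derivative at 0 of the same function along an orbit. -/
theorem X_res {c : ℂ} (hc : ‖c‖ = 1) (P : Poly) :
    X c (res P) = res (c • Lpoly P + conj c • Lbarpoly P) := by
  ext z
  obtain ⟨A, hA, hA'⟩ := P.hasFDerivAt_value z
  have h0 : rot hc 0 (z : C2) = z := by simp [rot_apply]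
  have h0' : (rot hc 0).onSphere z = z := Subtype.ext h0
  have h1 := hasDerivAt_comp_rot hc (res P) z 0
  have h2 : HasDerivAt (fun s => Poly.value P (rot hc s z)) (A (quat c (rot hc 0 z))) 0 :=
    HasFDerivAt.comp_hasDerivAt (l := Poly.value P) (0 : ℝ) (by rwa [h0])
      (hasDerivAt_rot hc 0 (z : C2))
  rw [h0'] at h1
  rw [h0] at h2
  rw [h1.unique h2, hA']
  simp [res_apply, Lpoly_apply, Lbarpoly_apply]
  ring

theorem L_res (P : Poly) : L (res P) = res (Lpoly P) := by
  have h1 := X_res (c := 1) (by simp) P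
  have h2 := X_res (c := Complex.I) (by simp) P
  simp only [X, LinearMap.add_apply, LinearMap.smul_apply, map_add, map_smul, map_one,
    Complex.conj_I] at h1 h2
  replace h2 := congrArg (fun f => Complex.I • f) h2
  simp only [smul_add, smul_smul, mul_neg, Complex.I_mul_I] at h2
  linear_combination (norm := module) (1 / 2 : ℂ) • h1 - (1 / 2 : ℂ) • h2

theorem Lbar_res (P : Poly) : Lbar (res P) = res (Lbarpoly P) := by
  have h1 := X_res (c := 1) (by simp) P
  simp only [X, LinearMap.add_apply, map_add, map_one, one_smul, L_res] at h1
  exact add_left_cancel h1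

/-- The algebra homomorphism from polynomials to continuous functions on the sphere. -/
def polyC : Poly →ₐ[ℂ] C(S3, ℂ) :=
  MvPolynomial.aeval (Sum.elim
    (fun i => ⟨fun z => (z : C2) i, by fun_prop⟩)
    (fun i => ⟨fun z => conj ((z : C2) i), by fun_prop⟩))

theorem polyC_apply (P : Poly) (z : S3) : polyC P z = Poly.value P z := by
  have : (ContinuousMap.evalAlgHom ℂ ℂ z).comp polyC =
      MvPolynomial.aeval (Sum.elim (fun i => (z : C2) i) (fun i => conj ((z : C2) i))) := by
    apply MvPolynomial.algHom_ext
    rintro (i | i) <;> simp [polyC]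
  have h := DFunLike.congr_fun this P
  rw [MvPolynomial.aeval_eq_eval] at h
  exact h

/-- Stone–Weierstrass: the star algebra generated by the coordinates separates points, and the
conjugate variables put it inside the range. -/
theorem denseRange_polyC : DenseRange polyC := by
  let s : Set C(S3, ℂ) := Set.range fun i : Fin 2 => polyC (MvPolynomial.X (Sum.inl i))
  have hsep : (StarAlgebra.adjoin ℂ s).SeparatesPoints := by
    intro z w hzw
    by_contra hcon
    apply hzw
    ext i
    by_contra hi
    refine hcon ⟨_, ⟨polyC (MvPolynomial.X (Sum.inl i)),
      StarAlgebra.subset_adjoin ℂ s ⟨i, rfl⟩, rfl⟩, ?_⟩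
    simpa [polyC_apply, Poly.value] using hi
  have htop := ContinuousMap.starSubalgebra_topologicalClosure_eq_top_of_separatesPoints _ hsep
  have hle : (StarAlgebra.adjoin ℂ s).toSubalgebra ≤ polyC.range := by
    rw [StarAlgebra.adjoin_toSubalgebra, Algebra.adjoin_le_iff]
    rintro g (⟨i, rfl⟩ | ⟨i, hi⟩)
    · exact ⟨_, rfl⟩
    · refine ⟨MvPolynomial.X (Sum.inr i), ?_⟩
      apply star_injective
      rw [← hi]
      ext z
      simp [polyC_apply, Poly.value]
  intro g
  have hg : g ∈ (StarAlgebra.adjoin ℂ s).topologicalClosure := htop ▸ trivial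
  exact closure_mono (s := (StarAlgebra.adjoin ℂ s : Set C(S3, ℂ))) (fun x hx => hle hx) hg

theorem denseRange_toL2_res : DenseRange fun P : Poly => toL2 (res P) := by
  have h := (ContinuousMap.toLp_denseRange ℂ sigma ℂ (p := 2) (by simp)).comp denseRange_polyC
    (ContinuousMap.toLp 2 sigma ℂ).continuous
  convert h using 1
  funext P
  change ContinuousMap.toLp 2 sigma ℂ _ = ContinuousMap.toLp 2 sigma ℂ _
  congr 1
  ext z
  exact (polyC_apply P z).symm

theorem eq_zero_of_inner_res {u : L2S3} (hu : ∀ P : Poly, inner ℂ (toL2 (res P)) u = 0) :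
    u = 0 := by
  refine denseRange_toL2_res.eq_zero_of_inner_left ℂ ?_
  intro P
  rw [← inner_conj_symm, hu P, map_zero]

end Rossi

/-! ### A criterion for essential self-adjointness. -/

section AbstractSelfAdjoint

variable {H : Type*} [NormedAddCommGroup H] [InnerProductSpace ℂ H] [CompleteSpace H]

/-- A densely defined symmetric operator whose domain contains an increasing sequence of invariant
finite dimensional subspaces with dense union is essentially self-adjoint. -/
theorem LinearPMap.isSelfAdjoint_closure_of_invariant {A : H →ₗ.[ℂ] H}
    (hA : A.IsFormalAdjoint A) (V : ℕ → Submodule ℂ H)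
    [hfin : ∀ n, FiniteDimensional ℂ (V n)] (hmono : Monotone V)
    (htop : ⊤ ≤ (⨆ n, V n).topologicalClosure) (hdom : ∀ n, V n ≤ A.domain)
    (hinv : ∀ n (x : A.domain), (x : H) ∈ V n → A x ∈ V n) : IsSelfAdjoint A.closure := by
  have hdense : Dense (A.domain : Set H) := by
    intro x
    exact Submodule.topologicalClosure_mono (iSup_le hdom) (htop (Submodule.mem_top (x := x)))
  have hle : A ≤ A.adjoint := LinearPMap.IsFormalAdjoint.le_adjoint hdense hA
  have hclosed : A.adjoint.IsClosed := LinearPMap.adjoint_isClosed hdense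
  have hclosable : A.IsClosable := hclosed.isClosable.leIsClosable hle
  have hgraph := hclosable.graph_closure_eq_closure_graph
  have hgle : A.closure.graph ≤ A.adjoint.graph := by
    rw [← hgraph]
    exact Submodule.topologicalClosure_minimal _ (LinearPMap.le_graph_of_le hle) hclosed
  -- Let `p` be the orthogonal projection onto `V n`. As `V n` is invariant and `A` symmetric, `A (p
  -- x) = p y` for every `(x, y)` in the graph of the adjoint. These pairs lie in the graph of `A`
  -- and converge to `(x, y)`.
  have hgge : A.adjoint.graph ≤ A.closure.graph := by
    rintro ⟨x, y⟩ hxy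
    rw [LinearPMap.adjoint_graph_eq_graph_adjoint hdense] at hxy
    rw [Submodule.mem_adjoint_iff] at hxy
    rw [← hgraph]
    have hx := Submodule.starProjection_tendsto_self V hmono x htop
    have hy := Submodule.starProjection_tendsto_self V hmono y htop
    refine mem_closure_of_tendsto (hx.prodMk_nhds hy) (Filter.Eventually.of_forall fun n => ?_)
    have hmem : (V n).starProjection x ∈ V n := Submodule.starProjection_apply_mem _ _
    refine (LinearPMap.mem_graph_iff A).2 ⟨⟨_, hdom n hmem⟩, rfl, ?_⟩
    refine (Submodule.eq_starProjection_of_mem_of_inner_eq_zero (hinv n _ hmem) ?_).symm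
    intro w hw
    have h1 := hxy w (A ⟨w, hdom n hw⟩) ((LinearPMap.mem_graph_iff A).2 ⟨⟨w, hdom n hw⟩, rfl, rfl⟩)
    have h2 := hA ⟨w, hdom n hw⟩ ⟨_, hdom n hmem⟩
    have h3 := Submodule.starProjection_inner_eq_zero (K := V n) x _ (hinv n ⟨w, hdom n hw⟩ hw)
    rw [inner_sub_left, sub_eq_zero] at h3 ⊢
    rw [sub_eq_zero] at h1
    rw [← inner_conj_symm, ← inner_conj_symm (_ : H) w, ← h1, ← h2, inner_conj_symm,
      inner_conj_symm, h3]
  have heq : A.closure = A.adjoint := LinearPMap.eq_of_eq_graph (le_antisymm hgle hgge)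
  rw [LinearPMap.isSelfAdjoint_def]
  -- An operator and its closure have the same adjoint, since the defining identity is a closed
  -- condition on the graph.
  refine Eq.trans (LinearPMap.eq_of_eq_graph (le_antisymm ?_ ?_)) heq.symm
  · rw [LinearPMap.adjoint_graph_eq_graph_adjoint (hdense.mono A.le_closure.1),
      LinearPMap.adjoint_graph_eq_graph_adjoint hdense]
    intro x hx
    rw [Submodule.mem_adjoint_iff] at hx ⊢
    exact fun a b hab => hx a b (LinearPMap.le_graph_of_le A.le_closure hab)
  · rw [LinearPMap.adjoint_graph_eq_graph_adjoint (hdense.mono A.le_closure.1),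
      LinearPMap.adjoint_graph_eq_graph_adjoint hdense]
    intro x hx
    rw [Submodule.mem_adjoint_iff] at hx ⊢
    have hcl : _root_.IsClosed {p : H × H | inner ℂ p.2 x.1 - inner ℂ p.1 x.2 = 0} :=
      isClosed_eq (by fun_prop) continuous_const
    intro a b hab
    rw [← hgraph] at hab
    exact closure_minimal (fun p hp => hx p.1 p.2 hp) hcl hab

end AbstractSelfAdjoint

namespace MvPolynomial

variable {σ R : Type*} [CommSemiring R] {n : ℕ}

theorem IsHomogeneous.X_mul_pderiv {φ : MvPolynomial σ R} (h : φ.IsHomogeneous n) (i j : σ) :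
    (X j * pderiv i φ).IsHomogeneous n := by
  rcases n with _ | n
  · rw [← totalDegree_zero_iff_isHomogeneous, totalDegree_eq_zero_iff_eq_C] at h
    rw [h, pderiv_C, mul_zero]
    exact isHomogeneous_zero _ _ _
  · simpa [add_comm] using (isHomogeneous_X R j).mul h.pderiv

end MvPolynomial

/-! ### Self-adjointness of the Kohn Laplacian, and eigenvalues as points of the spectrum. -/

namespace Rossi

theorem isHomogeneous_Lpoly {P : Poly} {n : ℕ} (h : P.IsHomogeneous n) :
    (Lpoly P).IsHomogeneous n :=
  (h.X_mul_pderiv _ _).sub (h.X_mul_pderiv _ _)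

theorem isHomogeneous_Lbarpoly {P : Poly} {n : ℕ} (h : P.IsHomogeneous n) :
    (Lbarpoly P).IsHomogeneous n :=
  (h.X_mul_pderiv _ _).sub (h.X_mul_pderiv _ _)

/-- The Kohn Laplacian on polynomials. -/
def boxPoly (t : ℂ) (P : Poly) : Poly :=
  -((h t : ℂ) • (Lpoly (Lbarpoly P + t • Lpoly P)
    + conj t • Lbarpoly (Lbarpoly P + t • Lpoly P)))

theorem Ltbar_res (t : ℂ) (P : Poly) : Ltbar t (res P) = res (Lbarpoly P + t • Lpoly P) := by
  simp only [Ltbar, LinearMap.add_apply, LinearMap.smul_apply, L_res, Lbar_res, map_add, map_smul]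

theorem Lt_res (t : ℂ) (P : Poly) : Lt t (res P) = res (Lpoly P + conj t • Lbarpoly P) := by
  simp only [Lt, LinearMap.add_apply, LinearMap.smul_apply, L_res, Lbar_res, map_add, map_smul]

theorem box_res (t : ℂ) (P : Poly) : box t (res P) = res (boxPoly t P) := by
  rw [box_apply, Ltbar_res, Lt_res, boxPoly, map_neg, map_smul]

theorem IsHomogeneous.const_smul {P : Poly} {n : ℕ} (h : P.IsHomogeneous n) (c : ℂ) :
    (c • P).IsHomogeneous n :=
  (MvPolynomial.homogeneousSubmodule _ _ n).smul_mem c h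

theorem isHomogeneous_boxPoly (t : ℂ) {P : Poly} {n : ℕ} (hP : P.IsHomogeneous n) :
    (boxPoly t P).IsHomogeneous n := by
  have h1 : (Lbarpoly P + t • Lpoly P).IsHomogeneous n :=
    (isHomogeneous_Lbarpoly hP).add (IsHomogeneous.const_smul (isHomogeneous_Lpoly hP) t)
  exact (IsHomogeneous.const_smul ((isHomogeneous_Lpoly h1).add
    (IsHomogeneous.const_smul (isHomogeneous_Lbarpoly h1) _)) _).neg

theorem boxPoly_sum (t : ℂ) {ι : Type*} (s : Finset ι) (P : ι → Poly) :
    boxPoly t (∑ i ∈ s, P i) = ∑ i ∈ s, boxPoly t (P i) := by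
  simp only [boxPoly, map_sum, map_add, Finset.smul_sum, ← Finset.sum_add_distrib,
    ← Finset.sum_neg_distrib]

theorem totalDegree_boxPoly_le (t : ℂ) (P : Poly) :
    (boxPoly t P).totalDegree ≤ P.totalDegree := by
  conv_lhs => rw [← MvPolynomial.sum_homogeneousComponent P, boxPoly_sum]
  refine MvPolynomial.totalDegree_finsetSum_le fun i hi => ?_
  exact (isHomogeneous_boxPoly t (MvPolynomial.homogeneousComponent_isHomogeneous i P)
    ).totalDegree_le.trans (Finset.mem_range_succ_iff.1 hi)

theorem boxSmooth_apply (t : ℂ) (f : Smooth) (hf : toL2 f ∈ (boxSmooth t).domain) :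
    boxSmooth t ⟨toL2 f, hf⟩ = toL2 (box t f) := by
  change toL2 (box t ((LinearEquiv.ofInjective toL2 toL2_injective).symm ⟨toL2 f, hf⟩)) = _
  congr 2
  rw [LinearEquiv.symm_apply_eq]
  rfl

theorem isFormalAdjoint_boxSmooth (t : ℂ) : (boxSmooth t).IsFormalAdjoint (boxSmooth t) := by
  rintro ⟨_, f, rfl⟩ ⟨_, g, rfl⟩
  have hf := boxSmooth_apply t f ⟨f, rfl⟩
  have hg := boxSmooth_apply t g ⟨g, rfl⟩
  exact (congrArg (inner ℂ · (toL2 g)) hf).trans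
    ((inner_box_left t f g).trans (congrArg (inner ℂ (toL2 f)) hg.symm))

theorem isSelfAdjoint_boxL2 (t : ℂ) : IsSelfAdjoint (boxL2 t) := by
  let V : ℕ → Submodule ℂ L2S3 := fun n =>
    (MvPolynomial.restrictTotalDegree (Fin 2 ⊕ Fin 2) ℂ n).map (toL2 ∘ₗ res)
  have hV : ∀ P : Poly, toL2 (res P) ∈ V P.totalDegree := fun P =>
    ⟨P, (MvPolynomial.mem_restrictTotalDegree _ _ _).2 le_rfl, rfl⟩
  refine LinearPMap.isSelfAdjoint_closure_of_invariant (isFormalAdjoint_boxSmooth t) V ?_ ?_ ?_ ?_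
  · intro m n hmn
    refine Submodule.map_mono fun P hP => ?_
    rw [MvPolynomial.mem_restrictTotalDegree] at hP ⊢
    exact hP.trans hmn
  · intro u _
    refine closure_mono ?_ (denseRange_toL2_res u)
    rintro _ ⟨P, rfl⟩
    exact Submodule.mem_iSup_of_mem _ (hV P)
  · rintro n _ ⟨P, -, rfl⟩
    exact ⟨res P, rfl⟩
  · rintro n ⟨_, hx⟩ ⟨P, hP, rfl⟩
    refine ⟨boxPoly t P, ?_, ?_⟩
    · rw [SetLike.mem_coe, MvPolynomial.mem_restrictTotalDegree] at hP ⊢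
      exact (totalDegree_boxPoly_le t P).trans hP
    · rw [LinearMap.comp_apply, ← box_res]
      exact (boxSmooth_apply t (res P) hx).symm

theorem mem_spec_boxL2 {t : ℂ} {lam : ℂ} {f : Smooth} (hf : f ≠ 0) (h : box t f = lam • f) :
    lam ∈ spec (boxL2 t) := by
  rintro ⟨R, hR, -⟩
  have hle := (boxSmooth t).le_closure
  have hdom : toL2 f ∈ (boxSmooth t).domain := ⟨f, rfl⟩
  have h1 : boxL2 t ⟨toL2 f, hle.1 hdom⟩ = lam • toL2 f := by
    rw [← map_smul, ← h, ← boxSmooth_apply t f hdom]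
    exact (hle.2 rfl).symm
  have h2 := hR ⟨toL2 f, hle.1 hdom⟩
  rw [h1] at h2
  simp only [sub_self, map_zero] at h2
  exact hf (toL2_injective (by rw [← h2, map_zero]))

/-! ### Eigenforms of `L_t`, evenness of CR functions, and non-embeddability. -/

/-- The antipodal map acting on smooth functions. -/
def antipode : Smooth →ₗ[ℂ] Smooth where
  toFun f := ⟨fun z => f.1 (-z), ContMDiff.comp (I' := 𝓡 3) f.2 (contMDiff_neg_sphere (n := 3))⟩
  map_add' _ _ := rfl
  map_smul' _ _ := rfl

theorem antipode_apply (f : Smooth) (z : S3) : (antipode f).1 z = f.1 (-z) := rfl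

theorem inner_antipode (f g : Smooth) :
    inner ℂ (toL2 (antipode f)) (toL2 (antipode g)) = inner ℂ (toL2 f) (toL2 g) := by
  rw [inner_toL2, inner_toL2]
  have hU := (LinearIsometryEquiv.neg ℝ (E := C2)).measurePreserving_onSphere
  have hn : ∀ z : S3, (LinearIsometryEquiv.neg ℝ (E := C2)).onSphere z = -z := fun z => by
    ext1; simp
  have hc : Continuous fun z : S3 => g.1 z * conj (f.1 z) :=
    (continuous_coe _).mul (Complex.continuous_conj.comp (continuous_coe _))
  conv_rhs => rw [sigma, ← hU.map_eq]
  rw [integral_map hU.measurable.aemeasurable hc.aestronglyMeasurable]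
  simp only [hn, antipode_apply]

theorem antipode_antipode (f : Smooth) : antipode (antipode f) = f := by
  ext z
  simp [antipode_apply]

theorem _root_.MvPolynomial.IsHomogeneous.eval_smul {σ R : Type*} [CommSemiring R] [Fintype σ]
    {P : MvPolynomial σ R} {n : ℕ} (hP : P.IsHomogeneous n) (c : R) (x : σ → R) :
    MvPolynomial.eval (c • x) P = c ^ n * MvPolynomial.eval x P := by
  rw [MvPolynomial.eval_eq', MvPolynomial.eval_eq', Finset.mul_sum]
  refine Finset.sum_congr rfl fun d hd => ?_
  have hn : ∑ i, d i = n := by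
    rw [← hP (MvPolynomial.mem_support_iff.1 hd), ← Finsupp.degree_eq_sum,
      Finsupp.degree_eq_weight_one]
    rfl
  simp only [Pi.smul_apply, smul_eq_mul, mul_pow, Finset.prod_mul_distrib,
    Finset.prod_pow_eq_pow_sum, hn]
  ring

theorem antipode_res {P : Poly} {n : ℕ} (hP : P.IsHomogeneous n) :
    antipode (res P) = (-1 : ℂ) ^ n • res P := by
  ext z
  refine Eq.trans ?_ (hP.eval_smul (-1 : ℂ) _)
  rw [antipode_apply, res_apply, Poly.value]
  congr 2
  funext i
  rcases i with i | i <;> simp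

/-- `𝓛_t` as a derivation of polynomials. -/
def Ltpoly (t : ℂ) : Derivation ℂ Poly Poly := Lpoly + conj t • Lbarpoly

theorem Ltpoly_apply (t : ℂ) (P : Poly) : Ltpoly t P = Lpoly P + conj t • Lbarpoly P := rfl

theorem _root_.Derivation.apply_mul_of_eigen {R A : Type*} [CommRing R] [CommRing A] [Algebra R A]
    (D : Derivation R A A) {x y : A} {α β : R} (hx : D x = α • x) (hy : D y = β • y) :
    D (x * y) = (α + β) • (x * y) := by
  rw [D.leibniz, hx, hy]
  simp only [Algebra.smul_def, map_add, Algebra.algebraMap_self, RingHom.id_apply]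
  ring

theorem _root_.Derivation.apply_pow_of_eigen {R A : Type*} [CommRing R] [CommRing A] [Algebra R A]
    (D : Derivation R A A) {x : A} {α : R} (hx : D x = α • x) (n : ℕ) :
    D (x ^ n) = (n * α) • x ^ n := by
  induction n with
  | zero => simp
  | succ n ih =>
    rw [pow_succ, D.apply_mul_of_eigen ih hx]
    push_cast
    congr 1
    ring

/-- The linear forms `z̄₂ + b z₁`. -/
def formA (b : ℂ) : Poly := MvPolynomial.X (Sum.inr 1) + b • MvPolynomial.X (Sum.inl 0)

/-- The linear forms `z̄₁ + b z₂`. -/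
def formB (b : ℂ) : Poly := MvPolynomial.X (Sum.inr 0) + b • MvPolynomial.X (Sum.inl 1)

theorem isHomogeneous_formA (b : ℂ) : (formA b).IsHomogeneous 1 :=
  (MvPolynomial.isHomogeneous_X _ _).add
    (IsHomogeneous.const_smul (MvPolynomial.isHomogeneous_X _ _) b)

theorem isHomogeneous_formB (b : ℂ) : (formB b).IsHomogeneous 1 :=
  (MvPolynomial.isHomogeneous_X _ _).add
    (IsHomogeneous.const_smul (MvPolynomial.isHomogeneous_X _ _) b)

/-- `L_t` sends `z₁` to `-z̄₂` and `z̄₂` to `t̄ z₁`; on their span its square is `-t̄`, so its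
eigenvalues are the square roots of `-t̄`. -/
theorem Ltpoly_formA {t b : ℂ} (hb : b ^ 2 = -conj t) : Ltpoly t (formA b) = (-b) • formA b := by
  have hb' : conj t = -b ^ 2 := by rw [hb, neg_neg]
  simp only [Ltpoly_apply, Lpoly_apply, Lbarpoly_apply, formA, hb', map_add, Derivation.map_smul,
    MvPolynomial.pderiv_X, Pi.single_apply]
  simp
  module

theorem Ltpoly_formB {t b : ℂ} (hb : b ^ 2 = -conj t) : Ltpoly t (formB b) = b • formB b := by
  have hb' : conj t = -b ^ 2 := by rw [hb, neg_neg]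
  simp only [Ltpoly_apply, Lpoly_apply, Lbarpoly_apply, formB, hb', map_add, Derivation.map_smul,
    MvPolynomial.pderiv_X, Pi.single_apply]
  simp
  module

/-- The monomials in the eigenforms of `𝓛_t`. -/
def eigenMonomial (a : ℂ) (k l m n : ℕ) : Poly :=
  formA a ^ k * formA (-a) ^ l * (formB a ^ m * formB (-a) ^ n)

theorem isHomogeneous_eigenMonomial (a : ℂ) (k l m n : ℕ) :
    (eigenMonomial a k l m n).IsHomogeneous (k + l + (m + n)) := by
  have h := (((isHomogeneous_formA a).pow k).mul ((isHomogeneous_formA (-a)).pow l)).mul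
    (((isHomogeneous_formB a).pow m).mul ((isHomogeneous_formB (-a)).pow n))
  simp only [one_mul] at h
  exact h

/-- What matters is that the integer factor has the parity of the degree `k + l + m + n`, so it is
nonzero in odd degree. -/
theorem Ltpoly_eigenMonomial {t a : ℂ} (ha : a ^ 2 = -conj t) (k l m n : ℕ) :
    Ltpoly t (eigenMonomial a k l m n) =
      ((-(k : ℤ) + l + m - n : ℤ) * a : ℂ) • eigenMonomial a k l m n := by
  have ha' : (-a) ^ 2 = -conj t := by rw [neg_sq, ha]
  have h := (Ltpoly t).apply_mul_of_eigen
    ((Ltpoly t).apply_mul_of_eigen ((Ltpoly t).apply_pow_of_eigen (Ltpoly_formA ha) k)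
      ((Ltpoly t).apply_pow_of_eigen (Ltpoly_formA ha') l))
    ((Ltpoly t).apply_mul_of_eigen ((Ltpoly t).apply_pow_of_eigen (Ltpoly_formB ha) m)
      ((Ltpoly t).apply_pow_of_eigen (Ltpoly_formB ha') n))
  refine h.trans ?_
  rw [eigenMonomial]
  congr 1
  push_cast
  ring

/-- The substitution of the eigenforms of `𝓛_t` for the variables. -/
def eigenSubst (a : ℂ) : Poly →ₐ[ℂ] Poly :=
  MvPolynomial.aeval (Sum.elim ![formA a, formA (-a)] ![formB a, formB (-a)])

theorem eigenSubst_monomial (a : ℂ) (d : Fin 2 ⊕ Fin 2 →₀ ℕ) (c : ℂ) :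
    eigenSubst a (MvPolynomial.monomial d c) =
      c • eigenMonomial a (d (Sum.inl 0)) (d (Sum.inl 1)) (d (Sum.inr 0)) (d (Sum.inr 1)) := by
  rw [eigenSubst, MvPolynomial.aeval_monomial, Finsupp.prod_fintype _ _ (by simp),
    Fintype.prod_sum_type, Fin.prod_univ_two, Fin.prod_univ_two, Algebra.smul_def]
  rfl

/-- Half sums and half differences of the forms for `a` and `-a` recover the variables; the
differences require division by `a`. -/
theorem eigenSubst_surjective {a : ℂ} (ha : a ≠ 0) : Function.Surjective (eigenSubst a) := by
  rw [← AlgHom.range_eq_top, ← top_le_iff, ← MvPolynomial.adjoin_range_X, Algebra.adjoin_le_iff]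
  rintro _ ⟨i, rfl⟩
  have h1 : formA a ∈ (eigenSubst a).range := ⟨MvPolynomial.X (Sum.inl 0), by simp [eigenSubst]⟩
  have h2 : formA (-a) ∈ (eigenSubst a).range := ⟨MvPolynomial.X (Sum.inl 1), by simp [eigenSubst]⟩
  have h3 : formB a ∈ (eigenSubst a).range := ⟨MvPolynomial.X (Sum.inr 0), by simp [eigenSubst]⟩
  have h4 : formB (-a) ∈ (eigenSubst a).range := ⟨MvPolynomial.X (Sum.inr 1), by simp [eigenSubst]⟩
  have key : ∀ {P Q : Poly} (α β : ℂ), P ∈ (eigenSubst a).range → Q ∈ (eigenSubst a).range →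
      α • P + β • Q ∈ (eigenSubst a).range := fun α β hP hQ =>
    add_mem (Subalgebra.smul_mem _ hP α) (Subalgebra.smul_mem _ hQ β)
  have e1 : (1 / (2 * a)) * a = 1 / 2 := by field_simp
  rcases i with i | i <;> fin_cases i
  · refine (congrArg (· ∈ (eigenSubst a).range) ?_).mp (key (1 / (2 * a)) (-(1 / (2 * a))) h1 h2)
    simp only [formA, smul_add, smul_smul, mul_neg, neg_mul, e1, Fin.zero_eta]
    module
  · refine (congrArg (· ∈ (eigenSubst a).range) ?_).mp (key (1 / (2 * a)) (-(1 / (2 * a))) h3 h4)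
    simp only [formB, smul_add, smul_smul, mul_neg, neg_mul, e1, Fin.mk_one]
    module
  · refine (congrArg (· ∈ (eigenSubst a).range) ?_).mp (key (1 / 2) (1 / 2) h3 h4)
    simp only [formB, Fin.zero_eta]
    module
  · refine (congrArg (· ∈ (eigenSubst a).range) ?_).mp (key (1 / 2) (1 / 2) h1 h2)
    simp only [formA, Fin.mk_one]
    module

theorem eq_zero_of_inner_eigenMonomial {a : ℂ} (ha : a ≠ 0) {u : L2S3}
    (hu : ∀ k l m n, inner ℂ (toL2 (res (eigenMonomial a k l m n))) u = 0) : u = 0 := by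
  refine eq_zero_of_inner_res fun P => ?_
  obtain ⟨Q, rfl⟩ := eigenSubst_surjective ha P
  rw [Q.as_sum]
  simp only [map_sum, eigenSubst_monomial, map_smul, sum_inner, inner_smul_left, hu, mul_zero,
    Finset.sum_const_zero]

/-- CR functions on the Rossi sphere are even. -/
theorem antipode_eq_of_Ltbar_eq_zero {t : ℂ} (ht : t ≠ 0) {g : Smooth} (hg : Ltbar t g = 0) :
    antipode g = g := by
  obtain ⟨a, ha⟩ := IsAlgClosed.exists_pow_nat_eq (-conj t) (n := 2) (by norm_num)
  have ha0 : a ≠ 0 := by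
    rintro rfl
    have := ha.symm
    simp [ht] at this
  rw [← sub_eq_zero]
  refine toL2_injective ((eq_zero_of_inner_eigenMonomial ha0 fun k l m n => ?_).trans
    (map_zero toL2).symm)
  have h1 : inner ℂ (toL2 (res (eigenMonomial a k l m n))) (toL2 (antipode g)) =
      (-1) ^ (k + l + (m + n)) * inner ℂ (toL2 (res (eigenMonomial a k l m n))) (toL2 g) := by
    rw [← inner_antipode, antipode_antipode, antipode_res (isHomogeneous_eigenMonomial a k l m n),
      map_smul, inner_smul_left]
    simp
  rw [map_sub, inner_sub_right, h1]
  rcases Nat.even_or_odd (k + l + (m + n)) with he | ho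
  · rw [he.neg_one_pow, one_mul, sub_self]
  -- In odd degree, `0 = ⟨Ltbar g, E⟩ = -⟨g, L_t E⟩` is a nonzero multiple of `⟨g, E⟩`.
  · have h2 := inner_Ltbar t g (res (eigenMonomial a k l m n))
    rw [hg, map_zero, inner_zero_left, Lt_res, ← Ltpoly_apply, Ltpoly_eigenMonomial ha,
      map_smul, map_smul, inner_smul_right, eq_comm, neg_eq_zero] at h2
    have hne : ((-(k : ℤ) + l + m - n : ℤ) : ℂ) ≠ 0 := by
      rw [Int.cast_ne_zero]
      obtain ⟨r, hr⟩ := ho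
      omega
    have h3 := (mul_eq_zero.1 h2).resolve_left (mul_ne_zero hne ha0)
    rw [inner_eq_zero_symm.1 h3, mul_zero, sub_zero]

theorem not_isCREmbedding {t : ℂ} (ht : t ≠ 0) {N : ℕ} (g : Fin N → Smooth) :
    ¬ IsCREmbedding t g := by
  rintro ⟨hemb, hker⟩
  let z : S3 := ⟨EuclideanSpace.single 0 1, by simp⟩
  have h : -z = z := by
    apply hemb.isEmbedding.injective
    ext j
    exact congrArg (fun f : Smooth => f.1 z) (antipode_eq_of_Ltbar_eq_zero ht (hker j))
  have h0 := congrArg (fun w : S3 => (w : C2) 0) h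
  norm_num [z, neg_eq_iff_add_eq_zero] at h0

/-! ### The `sl₂` action and the string generated by a primitive vector. -/

open MvPolynomial in
theorem pderiv_comm {σ R : Type*} [CommRing R] (i j : σ) (P : MvPolynomial σ R) :
    pderiv i (pderiv j P) = pderiv j (pderiv i P) := by
  classical
  have h : ⁅(pderiv i : Derivation R (MvPolynomial σ R) (MvPolynomial σ R)),
      (pderiv j : Derivation R (MvPolynomial σ R) (MvPolynomial σ R))⁆ = 0 := by
    refine MvPolynomial.derivation_ext fun k => ?_
    simp [Derivation.commutator_apply, Pi.single_apply, apply_ite]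
  have := DFunLike.congr_fun h P
  rwa [Derivation.commutator_apply, Derivation.coe_zero, Pi.zero_apply, sub_eq_zero] at this

/-- `Lbarpoly` commutes with the Laplacian. -/
theorem isHarmonic_Lbarpoly {P : Poly} (hP : P.IsHarmonic) : (Lbarpoly P).IsHarmonic := by
  have h : 4 * ∑ i : Fin 2, MvPolynomial.pderiv (Sum.inl i) (MvPolynomial.pderiv (Sum.inr i)
      (Lbarpoly P)) = Lbarpoly (4 * ∑ i : Fin 2, MvPolynomial.pderiv (Sum.inl i)
        (MvPolynomial.pderiv (Sum.inr i) P)) := by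
    have h4 : (4 : Poly) = MvPolynomial.C 4 := (map_ofNat MvPolynomial.C 4).symm
    rw [h4]
    simp only [Lbarpoly_apply, Fin.sum_univ_two, map_sub, map_add, MvPolynomial.pderiv_mul,
      MvPolynomial.pderiv_X, MvPolynomial.pderiv_C, Pi.single_apply]
    simp
    rw [pderiv_comm (Sum.inr 1) (Sum.inl 0), pderiv_comm (Sum.inr 1) (Sum.inl 1),
      pderiv_comm (Sum.inr 0) (Sum.inl 0), pderiv_comm (Sum.inr 0) (Sum.inl 1),
      pderiv_comm (Sum.inr 1) (Sum.inr 0)]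
    ring
  rw [Poly.IsHarmonic, h, hP, map_zero]

/-- The derivation acting on polynomials of bidegree `(p, q)` as multiplication by `p - q`. -/
def weightDeriv : Derivation ℂ Poly Poly :=
  ∑ i : Fin 2, ((MvPolynomial.X (Sum.inl i) : Poly) • MvPolynomial.pderiv (Sum.inl i)
    - (MvPolynomial.X (Sum.inr i) : Poly) • MvPolynomial.pderiv (Sum.inr i))

theorem weightDeriv_apply (P : Poly) : weightDeriv P =
    ∑ i : Fin 2, (MvPolynomial.X (Sum.inl i) * MvPolynomial.pderiv (Sum.inl i) P
      - MvPolynomial.X (Sum.inr i) * MvPolynomial.pderiv (Sum.inr i) P) := by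
  simp [weightDeriv]

theorem commutator_L_Lbar : ⁅Lpoly, Lbarpoly⁆ = weightDeriv := by
  refine MvPolynomial.derivation_ext fun k => ?_
  rcases k with k | k <;> fin_cases k <;>
  simp [Derivation.commutator_apply, weightDeriv_apply, Lpoly_apply, Lbarpoly_apply,
    Pi.single_apply]

theorem commutator_weight_Lbar : ⁅weightDeriv, Lbarpoly⁆ = (2 : ℂ) • Lbarpoly := by
  refine MvPolynomial.derivation_ext fun k => ?_
  rcases k with k | k <;> fin_cases k <;>
  simp [Derivation.commutator_apply, weightDeriv_apply, Lbarpoly_apply, Pi.single_apply] <;>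
  module

/-- `f` is a highest weight vector of weight `m` for the action of `𝓛`, `𝓛̄`. -/
def IsPrimitive (m : ℕ) (f : Smooth) : Prop :=
  L f = 0 ∧ ∀ j : ℕ, L ((Lbar ^ (j + 1)) f) = (-((j + 1) * (m - j)) : ℂ) • (Lbar ^ j) f

theorem Lbar_pow_succ (j : ℕ) (f : Smooth) : (Lbar ^ (j + 1)) f = Lbar ((Lbar ^ j) f) := by
  rw [pow_succ', Module.End.mul_apply]

theorem Lbar_pow_res (j : ℕ) (P : Poly) : (Lbar ^ j) (res P) = res (Lbarpoly^[j] P) := by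
  induction j with
  | zero => rfl
  | succ j ih => rw [Lbar_pow_succ, ih, Lbar_res, Function.iterate_succ_apply']

theorem isHomogeneous_of_isBihomogeneous {P : Poly} {p q : ℕ} (hP : P.IsBihomogeneous p q) :
    P.IsHomogeneous (p + q) := by
  intro d hd
  obtain ⟨h1, h2⟩ := hP d (MvPolynomial.mem_support_iff.2 hd)
  rw [← h1, ← h2, ← Fin.sum_univ_two (fun i => d (Sum.inl i)),
    ← Fin.sum_univ_two (fun i => d (Sum.inr i)), ← Fintype.sum_sum_type d,
    ← Finsupp.degree_eq_sum, Finsupp.degree_eq_weight_one]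
  rfl

/-- No `z` occurs in `P`, so `L` kills it and its weight is `-m`. Each application of `Lbar` raises
the weight by 2, and summing the weights through the commutator gives the factor `-(j+1)(m-j)`. -/
theorem isPrimitive_res {P : Poly} {m : ℕ} (hP : P.IsBihomogeneous 0 m) :
    IsPrimitive m (res P) := by
  have hd : ∀ i : Fin 2, MvPolynomial.pderiv (Sum.inl i) P = 0 := by
    intro i
    refine MvPolynomial.pderiv_eq_zero_of_notMem_vars fun hi => ?_
    obtain ⟨d, hd, hi⟩ := (MvPolynomial.mem_vars_iff_mem_support _).1 hi
    have h0 := (hP d hd).1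
    have h1 := Finsupp.mem_support_iff.1 hi
    fin_cases i <;> simp at h1 <;> omega
  have hL : Lpoly P = 0 := by rw [Lpoly_apply, hd, hd, mul_zero, mul_zero, sub_zero]
  have hw : weightDeriv P = (-m : ℂ) • P := by
    have h := (isHomogeneous_of_isBihomogeneous hP).sum_X_mul_pderiv
    rw [Fintype.sum_sum_type] at h
    simp only [hd, mul_zero, Finset.sum_const_zero, zero_add] at h
    rw [weightDeriv_apply]
    simp only [hd, mul_zero, zero_sub, Finset.sum_neg_distrib, h]
    rw [neg_smul, Nat.cast_smul_eq_nsmul]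
  have hwj : ∀ j : ℕ, weightDeriv (Lbarpoly^[j] P) = (2 * j - m : ℂ) • Lbarpoly^[j] P := by
    intro j
    induction j with
    | zero => simpa using hw
    | succ j ih =>
      have h := DFunLike.congr_fun commutator_weight_Lbar (Lbarpoly^[j] P)
      rw [Derivation.commutator_apply, ih, sub_eq_iff_eq_add] at h
      rw [Function.iterate_succ_apply', h, Derivation.map_smul, Derivation.smul_apply]
      push_cast
      module
  have hLj : ∀ j : ℕ, Lpoly (Lbarpoly^[j + 1] P) =
      (-((j + 1) * (m - j)) : ℂ) • Lbarpoly^[j] P := by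
    intro j
    induction j with
    | zero =>
      have h := DFunLike.congr_fun commutator_L_Lbar P
      rw [Derivation.commutator_apply, hL, map_zero, sub_zero, hw] at h
      simpa using h
    | succ j ih =>
      have h := DFunLike.congr_fun commutator_L_Lbar (Lbarpoly^[j + 1] P)
      rw [Derivation.commutator_apply, ih, hwj, sub_eq_iff_eq_add] at h
      rw [Function.iterate_succ_apply', h, Derivation.map_smul,
        ← Function.iterate_succ_apply' Lbarpoly j]
      push_cast
      module
  refine ⟨by rw [L_res, hL, map_zero], fun j => ?_⟩
  rw [Lbar_pow_res, Lbar_pow_res, L_res, hLj, map_smul]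

section Primitive

variable {m : ℕ} {f : Smooth}

theorem IsPrimitive.inner_succ (hf : IsPrimitive m f) (i j : ℕ) :
    inner ℂ (toL2 ((Lbar ^ (i + 1)) f)) (toL2 ((Lbar ^ (j + 1)) f)) =
      ((j + 1) * (m - j) : ℂ) * inner ℂ (toL2 ((Lbar ^ i) f)) (toL2 ((Lbar ^ j) f)) := by
  rw [Lbar_pow_succ i, inner_Lbar, hf.2, map_smul, inner_smul_right]
  ring

theorem IsPrimitive.inner_zero_succ (hf : IsPrimitive m f) (j : ℕ) :
    inner ℂ (toL2 f) (toL2 ((Lbar ^ (j + 1)) f)) = 0 := by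
  have h := inner_L f ((Lbar ^ j) f)
  rw [hf.1, map_zero, inner_zero_left, ← Lbar_pow_succ] at h
  exact neg_eq_zero.1 h.symm

theorem IsPrimitive.inner_eq_zero (hf : IsPrimitive m f) {i j : ℕ} (hij : i < j) :
    inner ℂ (toL2 ((Lbar ^ i) f)) (toL2 ((Lbar ^ j) f)) = 0 := by
  obtain ⟨d, rfl⟩ := Nat.exists_eq_add_of_lt hij
  clear hij
  induction i with
  | zero => simpa using hf.inner_zero_succ d
  | succ i ih => rw [show i + 1 + d + 1 = i + d + 1 + 1 by ring, hf.inner_succ, ih, mul_zero]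

theorem IsPrimitive.norm_sq_succ (hf : IsPrimitive m f) (j : ℕ) :
    ‖toL2 ((Lbar ^ (j + 1)) f)‖ ^ 2 = ((j + 1) * (m - j)) * ‖toL2 ((Lbar ^ j) f)‖ ^ 2 := by
  have h := hf.inner_succ j j
  rw [inner_self_eq_norm_sq_to_K, inner_self_eq_norm_sq_to_K] at h
  refine Complex.ofReal_injective ?_
  push_cast
  exact h

/-- The string stops because the factor `m - j` in `norm_sq_succ` vanishes at `j = m`. -/
theorem IsPrimitive.Lbar_pow_eq_zero (hf : IsPrimitive m f) {n : ℕ} (hn : m < n) :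
    (Lbar ^ n) f = 0 := by
  obtain ⟨d, rfl⟩ := Nat.exists_eq_add_of_lt hn
  have h : (Lbar ^ (m + 1)) f = 0 := by
    apply toL2_injective
    rw [map_zero, ← norm_eq_zero, ← sq_eq_zero_iff, hf.norm_sq_succ, sub_self, mul_zero, zero_mul]
  rw [show m + d + 1 = d + (m + 1) by ring, pow_add, Module.End.mul_apply, h, map_zero]

theorem IsPrimitive.norm_sq_top (hf : IsPrimitive m f) :
    ‖toL2 ((Lbar ^ m) f)‖ ^ 2 = (m.factorial : ℝ) ^ 2 * ‖toL2 f‖ ^ 2 := by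
  have h : ∀ j ≤ m, (((m - j).factorial : ℕ) : ℝ) * ‖toL2 ((Lbar ^ j) f)‖ ^ 2 =
      m.factorial * j.factorial * ‖toL2 f‖ ^ 2 := by
    intro j
    induction j with
    | zero => simp
    | succ j ih =>
      intro hj
      have h := ih (by omega)
      obtain ⟨d, rfl⟩ := Nat.exists_eq_add_of_le hj
      rw [hf.norm_sq_succ]
      rw [show j + 1 + d - j = d + 1 by omega, Nat.factorial_succ d] at h
      rw [show j + 1 + d - (j + 1) = d by omega, Nat.factorial_succ j]
      push_cast at h ⊢
      linear_combination (j + 1 : ℝ) * h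
  have := h m le_rfl
  rw [Nat.sub_self, Nat.factorial_zero, Nat.cast_one, one_mul] at this
  rw [this, sq (m.factorial : ℝ)]

end Primitive

/-! ### Rayleigh quotients on finite dimensional invariant spaces. -/

theorem h_pos {t : ℂ} (ht1 : ‖t‖ < 1) : 0 < h t := by
  have h1 : ‖t‖ ^ 2 < 1 := by nlinarith [norm_nonneg t]
  have h2 : 0 < 1 - ‖t‖ ^ 2 := by linarith
  unfold h
  positivity

theorem norm_toL2_pos {f : Smooth} (hf : f ≠ 0) : 0 < ‖toL2 f‖ :=
  norm_pos_iff.2 fun h0 => hf (toL2_injective (h0.trans (map_zero toL2).symm))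

/-- The variational characterization of the smallest eigenvalue of the Kohn Laplacian on a finite
dimensional invariant subspace. -/
theorem exists_isLeast_eigenvalue {t : ℂ} (ht1 : ‖t‖ < 1) (S : Submodule ℂ Smooth)
    [FiniteDimensional ℂ S] [Nontrivial S] (hS : ∀ u ∈ S, box t u ∈ S) :
    ∃ lam : ℝ, IsLeast {r : ℝ | ∃ u ∈ S, u ≠ 0 ∧ box t u = (r : ℂ) • u} lam ∧
      ∀ u ∈ S, lam * ‖toL2 u‖ ^ 2 ≤ h t * ‖toL2 (Ltbar t u)‖ ^ 2 := by
  let e := Submodule.equivMapOfInjective toL2 toL2_injective S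
  have he : ∀ u : S, (e u : L2S3) = toL2 u := fun u => rfl
  have : FiniteDimensional ℂ (S.map toL2) := Module.Finite.map S toL2
  have : Nontrivial (S.map toL2) := e.symm.toEquiv.nontrivial
  -- `Smooth` carries no inner product, so `box` is transported to the image of `S` in `L²`. There
  -- it is symmetric, and the infimum of its Rayleigh quotient is an eigenvalue.
  let T : S.map toL2 →ₗ[ℂ] S.map toL2 := e.conj ((box t).restrict hS)
  have hT : ∀ u : S, (T (e u) : L2S3) = toL2 (box t u) := fun u => by
    simp only [T, LinearEquiv.conj_apply_apply, LinearEquiv.symm_apply_apply, he]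
    rfl
  have hsymm : T.IsSymmetric := by
    intro x y
    obtain ⟨u, rfl⟩ := e.surjective x
    obtain ⟨v, rfl⟩ := e.surjective y
    rw [Submodule.coe_inner, Submodule.coe_inner, hT, hT]
    exact inner_box_left t u v
  have hq : ∀ u : S, RCLike.re (inner ℂ (T (e u)) (e u)) / ‖e u‖ ^ 2 =
      h t * ‖toL2 (Ltbar t u)‖ ^ 2 / ‖toL2 (u : Smooth)‖ ^ 2 := fun u => by
    rw [Submodule.coe_inner, hT, he, Submodule.coe_norm, he, inner_box_left, inner_box_right,
      inner_self_eq_norm_sq_to_K]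
    congr 1
    refine (Complex.re_ofReal_mul _ _).trans (congrArg _ ?_)
    norm_cast
  have hbdd : BddBelow (Set.range fun x : {x : S.map toL2 // x ≠ 0} =>
      RCLike.re (inner ℂ (T x) (x : S.map toL2)) / ‖(x : S.map toL2)‖ ^ 2) := by
    refine ⟨0, ?_⟩
    rintro _ ⟨⟨x, hx⟩, rfl⟩
    obtain ⟨u, rfl⟩ := e.surjective x
    have := (h_pos ht1).le
    simp only [hq]
    positivity
  have hle : ∀ u : S, u ≠ 0 → (⨅ x : {x : S.map toL2 // x ≠ 0},
      RCLike.re (inner ℂ (T x) (x : S.map toL2)) / ‖(x : S.map toL2)‖ ^ 2) ≤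
      h t * ‖toL2 (Ltbar t u)‖ ^ 2 / ‖toL2 (u : Smooth)‖ ^ 2 := fun u hu => by
    rw [← hq]
    exact ciInf_le hbdd ⟨e u, by simpa using hu⟩
  refine ⟨⨅ x : {x : S.map toL2 // x ≠ 0},
      RCLike.re (inner ℂ (T x) (x : S.map toL2)) / ‖(x : S.map toL2)‖ ^ 2,
    ⟨?_, ?_⟩, fun u hu => ?_⟩
  rotate_left 2
  · by_cases hu0 : u = 0
    · simp [hu0]
    · have := hle ⟨u, hu⟩ (by simpa using hu0)
      rwa [le_div_iff₀ (pow_pos (norm_toL2_pos hu0) 2)] at this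
  · obtain ⟨x, hx⟩ := hsymm.hasEigenvalue_iInf_of_finiteDimensional.exists_hasEigenvector
    obtain ⟨u, rfl⟩ := e.surjective x
    have hu0 : u ≠ 0 := by simpa using hx.2
    refine ⟨u, u.2, by simpa using hu0, toL2_injective ?_⟩
    have h1 := congrArg (Subtype.val : S.map toL2 → L2S3) hx.apply_eq_smul
    rw [hT] at h1
    rw [h1, map_smul]
    rfl
  · rintro r ⟨u, hu, hu0, hr⟩
    refine (hle ⟨u, hu⟩ (by simpa using hu0)).trans ?_
    rw [div_le_iff₀ (pow_pos (norm_toL2_pos hu0) 2)]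
    have h1 := inner_box_right t u u
    rw [hr, map_smul, inner_smul_right, inner_self_eq_norm_sq_to_K,
      inner_self_eq_norm_sq_to_K] at h1
    refine le_of_eq (Complex.ofReal_injective ?_)
    push_cast
    exact h1.symm

/-! ### The space `W` and the upper bound for its lowest eigenvalue. -/

section Estimate

variable {k : ℕ} {f : Smooth}

theorem Lbar_pow_odd_mem_W (hf : IsPrimitive (2 * k - 1) f) (j : ℕ) :
    (Lbar ^ (2 * j + 1)) f ∈ W k f := by
  by_cases hj : j < k
  · exact Submodule.subset_span ⟨⟨j, hj⟩, rfl⟩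
  · rw [hf.Lbar_pow_eq_zero (by omega)]
    exact zero_mem _

theorem mem_W_induction {p : Smooth → Prop} (h0 : p 0) (hadd : ∀ u v, p u → p v → p (u + v))
    (hsmul : ∀ (c : ℂ) u, p u → p (c • u)) (hpow : ∀ j, p ((Lbar ^ (2 * j + 1)) f))
    {u : Smooth} (hu : u ∈ W k f) : p u := by
  refine Submodule.span_induction ?_ h0 (fun u v _ _ => hadd u v) (fun c u _ => hsmul c u) hu
  rintro _ ⟨j, rfl⟩
  exact hpow j

/-- Both `L` and `Lbar` shift the exponent of `Lbar` by one, so `Ltbar` maps odd exponents to even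
ones and `Lt` maps them back. The ends of the string cause no loss, as `L f = 0` and the exponents
above `2k - 1` give zero. -/
theorem box_mem_W (t : ℂ) (hf : IsPrimitive (2 * k - 1) f) {u : Smooth} (hu : u ∈ W k f) :
    box t u ∈ W k f := by
  refine mem_W_induction (p := fun u => box t u ∈ W k f) ?h0 ?hadd ?hsmul ?hpow hu
  case h0 => simp
  case hadd => intro u v hu hv; rw [map_add]; exact add_mem hu hv
  case hsmul => intro c u hu; rw [map_smul]; exact Submodule.smul_mem _ c hu
  case hpow =>
    intro j
    have hL : ∀ j, L ((Lbar ^ (2 * j)) f) ∈ W k f := by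
      rintro (_ | j)
      · rw [mul_zero, pow_zero, Module.End.one_apply, hf.1]
        exact zero_mem _
      · rw [show 2 * (j + 1) = 2 * j + 1 + 1 by ring, hf.2]
        exact Submodule.smul_mem _ _ (Lbar_pow_odd_mem_W hf j)
    have hLbar : ∀ j, Lbar ((Lbar ^ (2 * j)) f) ∈ W k f := fun j => by
      rw [← Lbar_pow_succ]
      exact Lbar_pow_odd_mem_W hf j
    have hLt : ∀ j, Lt t ((Lbar ^ (2 * j)) f) ∈ W k f := fun j =>
      add_mem (hL j) (Submodule.smul_mem _ _ (hLbar j))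
    rw [box_apply]
    refine neg_mem (Submodule.smul_mem _ _ ?_)
    rw [Ltbar, LinearMap.add_apply, LinearMap.smul_apply, ← Lbar_pow_succ, hf.2, map_add, map_smul,
      map_smul]
    exact add_mem (hLt (j + 1)) (Submodule.smul_mem _ _ (Submodule.smul_mem _ _ (hLt j)))

theorem isSphericalHarmonic_of_mem_W {m : ℕ} {P : Poly} (hP : P.IsHomogeneous m)
    (hP' : P.IsHarmonic) {u : Smooth} (hu : u ∈ W k (res P)) : IsSphericalHarmonic m u := by
  refine mem_W_induction (p := IsSphericalHarmonic m) ?h0 ?hadd ?hsmul ?hpow hu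
  case h0 => exact ⟨0, MvPolynomial.isHomogeneous_zero _ _ _, by simp [Poly.IsHarmonic], by simp⟩
  case hadd =>
    rintro u v ⟨P, h1, h2, h3⟩ ⟨Q, h4, h5, h6⟩
    refine ⟨P + Q, h1.add h4, ?_, fun z => ?_⟩
    · rw [Poly.IsHarmonic] at h2 h5 ⊢
      simp only [map_add, Finset.sum_add_distrib, mul_add, h2, h5, add_zero]
    · simp [h3, h6]
  case hsmul =>
    rintro c u ⟨P, h1, h2, h3⟩
    refine ⟨c • P, IsHomogeneous.const_smul h1 c, ?_, fun z => ?_⟩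
    · rw [Poly.IsHarmonic] at h2 ⊢
      simp only [Derivation.map_smul, ← Finset.smul_sum, mul_smul_comm, h2, smul_zero]
    · simp [h3]
  case hpow =>
    intro j
    have h : ∀ n : ℕ, (Lbarpoly^[n] P).IsHomogeneous m ∧ (Lbarpoly^[n] P).IsHarmonic := by
      intro n
      induction n with
      | zero => exact ⟨hP, hP'⟩
      | succ n ih =>
        rw [Function.iterate_succ_apply']
        exact ⟨isHomogeneous_Lbarpoly ih.1, isHarmonic_Lbarpoly ih.2⟩
    refine ⟨_, (h (2 * j + 1)).1, (h (2 * j + 1)).2, fun z => ?_⟩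
    rw [Lbar_pow_res, res_apply]

/-- `Ltbar` sends `Lbar^(2p+1) f` to `Lbar^(2p+2) f - t (2p+1)(2k-1-2p) Lbar^(2p) f`. Starting from
the top vector, where the first term vanishes, the error is pushed down the string two exponents at
a time, gaining a factor `t` each time. The inner product with the top vector is unchanged by
orthogonality and later bounds `‖u‖` from below. -/
theorem exists_almost_CR (t : ℂ) (hf : IsPrimitive (2 * k - 1) f) (n p : ℕ) (hn : p + n + 1 = k) :
    ∃ u ∈ W k f, inner ℂ (toL2 ((Lbar ^ (2 * k - 1)) f)) (toL2 u) =
        inner ℂ (toL2 ((Lbar ^ (2 * k - 1)) f)) (toL2 ((Lbar ^ (2 * k - 1)) f)) ∧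
      Ltbar t u = (-(t ^ (n + 1) * ∏ i ∈ Finset.range (n + 1),
        ((2 * (i : ℂ) + 1) * (2 * (k : ℂ) - 1 - 2 * i)))) • (Lbar ^ (2 * p)) f := by
  have hm : ((2 * k - 1 : ℕ) : ℂ) = 2 * k - 1 := by
    rw [Nat.cast_sub (by omega)]
    push_cast
    ring
  induction n generalizing p with
  | zero =>
    obtain rfl : k = p + 1 := by omega
    refine ⟨(Lbar ^ (2 * p + 1)) f, Lbar_pow_odd_mem_W hf p, rfl, ?_⟩
    rw [Ltbar, LinearMap.add_apply, LinearMap.smul_apply, ← Lbar_pow_succ, hf.2,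
      hf.Lbar_pow_eq_zero (by omega), zero_add, smul_smul, hm]
    congr 1
    rw [Finset.prod_range_one]
    push_cast
    ring
  | succ n ih =>
    obtain ⟨u, hu, hu1, hu2⟩ := ih (p + 1) (by omega)
    set b : ℂ := ∏ i ∈ Finset.range (n + 1), ((2 * i + 1) * (2 * k - 1 - 2 * i)) with hb
    -- The coefficient is chosen to cancel the remaining error `-(t^(n+1) b) Lbar^(2p+2) f`.
    refine ⟨u + (t ^ (n + 1) * b) • (Lbar ^ (2 * p + 1)) f,
      add_mem hu (Submodule.smul_mem _ _ (Lbar_pow_odd_mem_W hf p)), ?_, ?_⟩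
    · rw [map_add, map_smul, inner_add_right, inner_smul_right,
        inner_eq_zero_symm.1 (hf.inner_eq_zero (show 2 * p + 1 < 2 * k - 1 by omega)), mul_zero,
        add_zero, hu1]
    · rw [map_add, map_smul, hu2, Ltbar, LinearMap.add_apply, LinearMap.smul_apply,
        ← Lbar_pow_succ, hf.2, hm, Finset.prod_range_succ, ← hb,
        show 2 * (p + 1) = 2 * p + 1 + 1 by ring]
      have hk : (k : ℂ) = p + n + 2 := by rw [← hn]; push_cast; ring
      rw [hk]
      push_cast
      module

theorem prod_odd_mul_reflect (k : ℕ) :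
    ∏ i ∈ Finset.range k, ((2 * i + 1) * (2 * k - 1 - 2 * i) : ℝ) =
      (∏ i ∈ Finset.range k, (2 * i + 1 : ℝ)) ^ 2 := by
  rw [Finset.prod_mul_distrib, sq]
  congr 1
  rw [← Finset.prod_range_reflect (fun i : ℕ => (2 * i + 1 : ℝ)) k]
  refine Finset.prod_congr rfl fun i hi => ?_
  have := Finset.mem_range.1 hi
  rw [Nat.sub_sub, Nat.cast_sub (by omega)]
  push_cast
  ring

/-- As `(2k+1)! = (2k+1)!! (2k)!!`, this says `((2k+1)!! / (2k)!!)² ≤ 2k+1`. The induction step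
reduces to `(2k+1)(2k+3) ≤ (2k+2)²`. -/
theorem prod_odd_pow_four_le (k : ℕ) :
    (∏ i ∈ Finset.range (k + 1), (2 * i + 1 : ℝ)) ^ 4 ≤
      (2 * k + 1) * ((2 * k + 1).factorial : ℝ) ^ 2 := by
  induction k with
  | zero => simp
  | succ k ih =>
    rw [Finset.prod_range_succ, show 2 * (k + 1) + 1 = 2 * k + 1 + 1 + 1 by ring,
      Nat.factorial_succ, Nat.factorial_succ]
    push_cast
    rw [mul_pow]
    refine (mul_le_mul_of_nonneg_right ih (by positivity)).trans ?_
    have : (2 * k + 1) * (2 * k + 3) ≤ ((2 * k + 2) ^ 2 : ℝ) := by nlinarith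
    calc (2 * (k : ℝ) + 1) * ((2 * k + 1).factorial : ℝ) ^ 2 * (2 * (k + 1) + 1) ^ 4
        = ((2 * k + 1) * (2 * k + 3)) * ((2 * k + 3) ^ 3 * ((2 * k + 1).factorial : ℝ) ^ 2) := by
          ring
      _ ≤ (2 * k + 2) ^ 2 * ((2 * k + 3) ^ 3 * ((2 * k + 1).factorial : ℝ) ^ 2) :=
          mul_le_mul_of_nonneg_right this (by positivity)
      _ = _ := by ring

/-- With `D = (2k-1)!!`, the test vector has `‖Ltbar u‖ = |t|^k D² ‖f‖`, while Cauchy–Schwarz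
against the top vector gives `‖u‖ ≥ (2k-1)! ‖f‖`. The bound on `D⁴` finishes the estimate. -/
theorem lowest_eigenvalue_le {t : ℂ} (ht1 : ‖t‖ < 1) (hk : 1 ≤ k) (hf0 : f ≠ 0)
    (hf : IsPrimitive (2 * k - 1) f) {lam : ℝ} (hlam : 0 ≤ lam)
    (h : ∀ u ∈ W k f, lam * ‖toL2 u‖ ^ 2 ≤ h t * ‖toL2 (Ltbar t u)‖ ^ 2) :
    lam ≤ Rossi.h t * (2 * k - 1) * ‖t‖ ^ (2 * k) := by
  obtain ⟨u, hu, hu1, hu2⟩ := exists_almost_CR t hf (k - 1) 0 (by omega)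
  rw [Nat.sub_add_cancel hk, mul_zero, pow_zero, Module.End.one_apply] at hu2
  set v := toL2 ((Lbar ^ (2 * k - 1)) f) with hv
  have hvu : ‖v‖ ^ 2 ≤ ‖v‖ * ‖toL2 u‖ := by
    have h1 := norm_inner_le_norm (𝕜 := ℂ) v (toL2 u)
    rw [hu1, inner_self_eq_norm_sq_to_K] at h1
    simpa using h1
  have hv0 : ‖v‖ ^ 2 = ((2 * k - 1).factorial : ℝ) ^ 2 * ‖toL2 f‖ ^ 2 := hf.norm_sq_top
  have hF := norm_toL2_pos hf0
  have hfac : (0 : ℝ) < (2 * k - 1).factorial := by positivity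
  have hvpos : 0 < ‖v‖ := by
    have : 0 < ‖v‖ ^ 2 := by rw [hv0]; positivity
    exact lt_of_le_of_ne (norm_nonneg _) fun h0 => by simp [← h0] at this
  have hle : ‖v‖ ≤ ‖toL2 u‖ := by
    rw [sq] at hvu
    exact le_of_mul_le_mul_left hvu hvpos
  set D : ℝ := ∏ i ∈ Finset.range k, (2 * i + 1 : ℝ) with hD
  have hprod : ∏ i ∈ Finset.range k, ((2 * (i : ℂ) + 1) * (2 * (k : ℂ) - 1 - 2 * i)) = (D ^ 2 : ℝ) := by
    rw [hD, ← prod_odd_mul_reflect]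
    push_cast
    rfl
  have hnorm : ‖toL2 (Ltbar t u)‖ = ‖t‖ ^ k * D ^ 2 * ‖toL2 f‖ := by
    rw [hu2, map_smul, norm_smul, norm_neg, norm_mul, norm_pow, hprod, Complex.norm_real,
      Real.norm_of_nonneg (by positivity)]
  have hD4 : D ^ 4 ≤ (2 * k - 1) * ((2 * k - 1).factorial : ℝ) ^ 2 := by
    obtain ⟨K, rfl⟩ := Nat.exists_eq_add_of_le' hk
    have := prod_odd_pow_four_le K
    rw [show 2 * (K + 1) - 1 = 2 * K + 1 by omega]
    push_cast
    rwa [show (2 * ((K : ℝ) + 1) - 1) = 2 * K + 1 by ring]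
  have h1 : lam * ‖v‖ ^ 2 ≤ Rossi.h t * (‖t‖ ^ k * D ^ 2 * ‖toL2 f‖) ^ 2 := by
    rw [← hnorm]
    refine le_trans ?_ (h u hu)
    gcongr
  have hh := (h_pos ht1).le
  have h2 : lam * (((2 * k - 1).factorial : ℝ) ^ 2 * ‖toL2 f‖ ^ 2) ≤
      Rossi.h t * (2 * k - 1) * ‖t‖ ^ (2 * k) *
        (((2 * k - 1).factorial : ℝ) ^ 2 * ‖toL2 f‖ ^ 2) := by
    rw [← hv0]
    refine h1.trans ?_
    rw [hv0]
    calc Rossi.h t * (‖t‖ ^ k * D ^ 2 * ‖toL2 f‖) ^ 2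
        = Rossi.h t * ‖t‖ ^ (2 * k) * ‖toL2 f‖ ^ 2 * D ^ 4 := by ring
      _ ≤ Rossi.h t * ‖t‖ ^ (2 * k) * ‖toL2 f‖ ^ 2 *
          ((2 * k - 1) * ((2 * k - 1).factorial : ℝ) ^ 2) := by gcongr
      _ = _ := by ring
  exact le_of_mul_le_mul_right h2 (by positivity)

theorem antipode_of_mem_W {m : ℕ} (hm : Odd m) {P : Poly} (hP : P.IsHomogeneous m)
    (hP' : P.IsHarmonic) {u : Smooth} (hu : u ∈ W k (res P)) : antipode u = -u := by
  obtain ⟨Q, hQ, -, hQu⟩ := isSphericalHarmonic_of_mem_W hP hP' hu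
  obtain rfl : u = res Q := Subtype.ext (funext hQu)
  rw [antipode_res hQ, hm.neg_one_pow]
  exact neg_one_smul ℂ (res Q)

end Estimate

theorem lowest_eigenvalue {t : ℂ} (ht : t ≠ 0) (ht1 : ‖t‖ < 1) {k : ℕ} (hk : 1 ≤ k) {f : Smooth}
    (hf0 : f ≠ 0) (hf : IsBisphericalHarmonic 0 (2 * k - 1) f) :
    (∀ u ∈ W k f, IsSphericalHarmonic (2 * k - 1) u) ∧ (∀ u ∈ W k f, box t u ∈ W k f) ∧
    ∃ lam : ℝ, IsLeast {r : ℝ | ∃ u ∈ W k f, u ≠ 0 ∧ box t u = (r : ℂ) • u} lam ∧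
      0 < lam ∧ lam ≤ h t * (2 * k - 1) * ‖t‖ ^ (2 * k) := by
  obtain ⟨P, hP, hP', hPf⟩ := hf
  obtain rfl : f = res P := Subtype.ext (funext hPf)
  have hprim := isPrimitive_res hP
  have hhom : P.IsHomogeneous (2 * k - 1) := by
    simpa only [zero_add] using isHomogeneous_of_isBihomogeneous hP
  have hbox : ∀ u ∈ W k (res P), box t u ∈ W k (res P) := fun u hu => box_mem_W t hprim hu
  refine ⟨fun u hu => isSphericalHarmonic_of_mem_W hhom hP' hu, hbox, ?_⟩
  have : FiniteDimensional ℂ (W k (res P)) :=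
    FiniteDimensional.span_of_finite ℂ (Set.finite_range _)
  have htop : (Lbar ^ (2 * k - 1)) (res P) ≠ 0 := by
    intro h0
    have h1 := hprim.norm_sq_top
    rw [h0, map_zero, norm_zero] at h1
    have := norm_toL2_pos hf0
    have : 0 < ((2 * k - 1).factorial : ℝ) ^ 2 * ‖toL2 (res P)‖ ^ 2 := by positivity
    simp [← h1] at this
  have hmem := Lbar_pow_odd_mem_W hprim (k - 1)
  rw [show 2 * (k - 1) + 1 = 2 * k - 1 by omega] at hmem
  have : Nontrivial (W k (res P)) := ⟨⟨_, hmem⟩, 0, by simpa using htop⟩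
  obtain ⟨lam, hleast, hlam⟩ := exists_isLeast_eigenvalue ht1 (W k (res P)) hbox
  -- An eigenvector with `Ltbar u = 0` would be even, whereas `W` consists of odd functions since
  -- its degree `2k - 1` is odd.
  have hpos : 0 < lam := by
    obtain ⟨u, hu, hu0, hlu⟩ := hleast.1
    have h1 := inner_box_right t u u
    rw [hlu, map_smul, inner_smul_right, inner_self_eq_norm_sq_to_K,
      inner_self_eq_norm_sq_to_K] at h1
    have h2 : lam * ‖toL2 u‖ ^ 2 = h t * ‖toL2 (Ltbar t u)‖ ^ 2 := by
      refine Complex.ofReal_injective ?_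
      push_cast
      exact h1
    have hne : Ltbar t u ≠ 0 := by
      intro h0
      have h3 := antipode_eq_of_Ltbar_eq_zero ht h0
      rw [antipode_of_mem_W ⟨k - 1, by omega⟩ hhom hP' hu] at h3
      have h5 : (2 : ℂ) • u = 0 := by
        rw [two_smul]
        nth_rw 1 [← h3]
        exact neg_add_cancel u
      exact hu0 ((smul_eq_zero.1 h5).resolve_left two_ne_zero)
    have h4 : 0 < lam * ‖toL2 u‖ ^ 2 := by
      rw [h2]
      exact mul_pos (h_pos ht1) (pow_pos (norm_toL2_pos hne) 2)
    exact pos_of_mul_pos_left h4 (by positivity)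
  exact ⟨lam, hleast, hpos, lowest_eigenvalue_le ht1 hk hf0 hprim hpos.le hlam⟩

/-! ### Zero as an accumulation point of the spectrum, and conclusion. -/

theorem exists_isBisphericalHarmonic (q : ℕ) : ∃ f : Smooth, f ≠ 0 ∧
    IsBisphericalHarmonic 0 q f := by
  refine ⟨res (MvPolynomial.monomial (Finsupp.single (Sum.inr 0) q) 1), fun h0 => ?_,
    _, ?_, ?_, fun z => rfl⟩
  · have := congrArg (fun f : Smooth => f.1 ⟨EuclideanSpace.single 0 1, by simp⟩) h0
    simp [res_apply, Poly.value, MvPolynomial.eval_monomial] at this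
  · intro d hd
    rw [Finset.mem_singleton.1 (MvPolynomial.support_monomial_subset hd)]
    simp
  · simp [Poly.IsHarmonic]

theorem zero_mem_spec (t : ℂ) : (0 : ℂ) ∈ spec (boxL2 t) := by
  refine mem_spec_boxL2 (f := res 1) (fun h0 => ?_) ?_
  · have := congrArg (fun f : Smooth => f.1 ⟨EuclideanSpace.single 0 1, by simp⟩) h0
    simp [res_apply, Poly.value] at this
  · rw [box_apply, Ltbar_res]
    simp

theorem accPt_zero_spec {t : ℂ} (ht : t ≠ 0) (ht1 : ‖t‖ < 1) :
    AccPt (0 : ℂ) (Filter.principal (spec (boxL2 t))) := by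
  have hex : ∀ n : ℕ, ∃ lam : ℝ, (lam : ℂ) ∈ spec (boxL2 t) ∧ 0 < lam ∧
      lam ≤ h t * (2 * (n + 1 : ℕ) - 1) * ‖t‖ ^ (2 * (n + 1)) := fun n => by
    obtain ⟨f, hf0, hf⟩ := exists_isBisphericalHarmonic (2 * (n + 1) - 1)
    obtain ⟨-, -, lam, hl, hpos, hle⟩ := lowest_eigenvalue ht ht1 (by omega) hf0 hf
    obtain ⟨u, -, hu0, hu⟩ := hl.1
    exact ⟨lam, mem_spec_boxL2 hu0 hu, hpos, hle⟩
  choose lam hspec hpos hle using hex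
  have hlim : Filter.Tendsto (fun n : ℕ => h t * (2 * (n + 1 : ℕ) - 1) * ‖t‖ ^ (2 * (n + 1)))
      Filter.atTop (𝓝 0) := by
    have hs : ‖t‖ ^ 2 < 1 := by nlinarith [norm_nonneg t]
    have h1 := tendsto_self_mul_const_pow_of_lt_one (sq_nonneg ‖t‖) hs
    have h2 := tendsto_pow_atTop_nhds_zero_of_lt_one (sq_nonneg ‖t‖) hs
    have h3 := (((h1.const_mul 2).sub h2).const_mul (h t)).comp (Filter.tendsto_add_atTop_nat 1)
    simp only [mul_zero, sub_zero] at h3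
    refine h3.congr fun n => ?_
    simp only [Function.comp_apply, ← pow_mul]
    ring
  have htend : Filter.Tendsto lam Filter.atTop (𝓝 0) :=
    squeeze_zero (fun n => (hpos n).le) hle hlim
  rw [accPt_iff_frequently]
  have htend' : Filter.Tendsto (fun n => (lam n : ℂ)) Filter.atTop (𝓝 0) := by
    simpa [Function.comp_def] using (Complex.continuous_ofReal.tendsto 0).comp htend
  -- Positivity is essential here: the eigenvalues tending to 0 must differ from 0.
  refine htend'.frequently (Filter.Frequently.of_forall fun n => ⟨?_, hspec n⟩)
  exact Complex.ofReal_ne_zero.2 (hpos n).ne'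

end Rossi

end

theorem mainTheorem1 (t : ℂ) (ht0 : 0 < ‖t‖) (ht1 : ‖t‖ < 1) :
    IsSelfAdjoint (Rossi.boxL2 t) ∧
    (0 : ℂ) ∈ Rossi.essSpec (Rossi.boxL2 t) ∧
    AccPt (0 : ℂ) (Filter.principal (Rossi.spec (Rossi.boxL2 t))) ∧
    (∀ k : ℕ, 1 ≤ k → ∀ f : Rossi.Smooth, f ≠ 0 → Rossi.IsBisphericalHarmonic 0 (2 * k - 1) f →
      (∀ u ∈ Rossi.W k f, Rossi.IsSphericalHarmonic (2 * k - 1) u) ∧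
      (∀ u ∈ Rossi.W k f, Rossi.box t u ∈ Rossi.W k f) ∧
      ∃ lam : ℝ,
        IsLeast {r : ℝ | ∃ u ∈ Rossi.W k f, u ≠ 0 ∧ Rossi.box t u = (r : ℂ) • u} lam ∧
        0 < lam ∧
        lam ≤ Rossi.h t * (2 * (k : ℝ) - 1) * Real.sqrt (k : ℝ) * ‖t‖ ^ (2 * k)) ∧
    (∀ N : ℕ, ¬ ∃ g : Fin N → Rossi.Smooth, Rossi.IsCREmbedding t g) := by
  have ht : t ≠ 0 := norm_pos_iff.1 ht0
  have hacc := Rossi.accPt_zero_spec ht ht1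
  refine ⟨Rossi.isSelfAdjoint_boxL2 t, ⟨Rossi.zero_mem_spec t, Or.inl hacc⟩, hacc, ?_, ?_⟩
  · intro k hk f hf0 hf
    obtain ⟨h1, h2, lam, h3, h4, h5⟩ := Rossi.lowest_eigenvalue ht ht1 hk hf0 hf
    refine ⟨h1, h2, lam, h3, h4, h5.trans ?_⟩
    have hk' : (1 : ℝ) ≤ k := by exact_mod_cast hk
    have hh := (Rossi.h_pos ht1).le
    have h6 : 0 ≤ Rossi.h t * (2 * (k : ℝ) - 1) := mul_nonneg hh (by linarith)
    -- The bound `h5` lacks the factor `√k`, which is at least 1.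
    exact mul_le_mul_of_nonneg_right
      (le_mul_of_one_le_right h6 (Real.one_le_sqrt.2 hk')) (by positivity)
  · rintro N ⟨g, hg⟩
    exact Rossi.not_isCREmbedding ht g hg
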